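/- Let $N\ge 2$ and $p>1$. Let $V:\mathbb R^N\to\mathbb R$ be Lebesgue measurable with $\operatorname{ess\,inf}_{\mathbb R^N}V>0$. Let $$X=\Big\{u\in W^{1,p}(\mathbb R^N)\cap L^\infty(\mathbb R^N):\ \int_{\mathbb R^N}V|u|^p\,dx<\infty\Big\},\qquad \|u\|_X=\|u\|_V+|u|_\infty,$$ where $\|u\|_V=\big(\int_{\mathbb R^N}|\nabla u|^p\,dx+\int_{\mathbb R^N}V|u|^p\,dx\big)^{1/p}$, $\nabla u$ is the weak gradient and $|u|_\infty=\operatorname{ess\,sup}|u|$. Call $h:\mathbb R^N\times\mathbb R\to\mathbb R$ a $\mathcal C^k$-Carathéodory function if $h(\cdot,t)$ is measurable for all $t\in\mathbb R$ and $h(x,\cdot)$ is $\mathcal C^k$ for a.e. $x\in\mathbb R^N$. Assume that - $A:\mathbb R^N\times\mathbb R\to\mathbb R$ is a $\mathcal C^1$-Carathéodory function, with $A_t=\partial A/\partial t$, and for every $\rho>0$ the functions $\sup_{|t|\le\rho}|A(\cdot,t)|$ and $\sup_{|t|\le\rho}|A_t(\cdot,t)|$ belong to $L^\infty(\mathbb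 R^N)$; - $g:\mathbb R^N\times\mathbb R\to\mathbb R$ is a $\mathcal C^0$-Carathéodory function, and there are $a_1,a_2>0$ and $q\ge p$ such that $|g(x,t)|\le a_1|t|^{p-1}+a_2|t|^{q-1}$ for a.e. $x\in\mathbb R^N$ and all $t\in\mathbb R$. Put $G(x,t)=\int_0^t g(x,s)\,ds$ and, for $u,v\in X$, $$J(u)=\frac1p\int_{\mathbb R^N}A(x,u)|\nabla u|^p\,dx+\frac1p\int_{\mathbb R^N}V(x)|u|^p\,dx-\int_{\mathbb R^N}G(x,u)\,dx,$$ $$\langle dJ(u),v\rangle=\int_{\mathbb R^N}A(x,u)|\nabla u|^{p-2}\nabla u\cdot\nabla v\,dx+\frac1p\int_{\mathbb R^N}A_t(x,u)\,v\,|\nabla u|^p\,dx+\int_{\mathbb R^N}V(x)|u|^{p-2}uv\,dx-\int_{\mathbb R^N}g(x,u)v\,dx .$$ Then all these integrals converge absolutely and $dJ(u)$ is a continuous linear functional on $X$ for every $u\in X$. If $(u_n)_n\subset X$, $u\in X$ and $M>0$ are such that $u_n\to u$ a.e. in $\mathbb R^N$, $\|u_n-u\|_V\to0$ and $|u_n|_\infty\le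 M$ for all $n$, then $$J(u_n)\to J(u)\qquad\text{and}\qquad \|dJ(u_n)-dJ(u)\|_{X'}\to0\qquad\text{as } n\to\infty .$$ Moreover $J$ is of class $\mathcal C^1$ on $X$, with Fréchet differential at $u$ equal to $dJ(u)$. -/

import Mathlib

open MeasureTheory Filter Set
open scoped Topology ENNReal ContDiff

namespace WeightedSobolev

/-- The Euclidean space `ℝ^N`. -/
abbrev E (N : ℕ) : Type := EuclideanSpace ℝ (Fin N)

/-- `V : ℝ^N → ℝ` is Lebesgue measurable and `ess inf V > 0`. -/
structure IsPotential {N : ℕ} (V : E N → ℝ) : Prop where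
  aemeasurable : AEMeasurable V volume
  essInf_pos : 0 < essInf V volume

/-- `h : ℝ^N × ℝ → ℝ` is a `C^k`-Carathéodory function. -/
structure IsCaratheodory {N : ℕ} (k : ℕ) (h : E N → ℝ → ℝ) : Prop where
  aemeasurable : ∀ t : ℝ, AEMeasurable (fun x => h x t) volume
  contDiff : ∀ᵐ x ∂(volume : Measure (E N)), ContDiff ℝ k (h x)

/-- For every `ρ > 0` the function `x ↦ sup_{|t| ≤ ρ} |h(x, t)|` is essentially bounded.
The supremum is taken in `[0, ∞]`. -/
def LocallyEssBounded {N : ℕ} (h : E N → ℝ → ℝ) : Prop :=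
  ∀ ρ : ℝ, 0 < ρ →
    essSup (fun x : E N => ⨆ t ∈ Icc (-ρ) ρ, ‖h x t‖ₑ) volume < (⊤ : ℝ≥0∞)

/-- The partial derivative `∂h/∂t (x, t)`. -/
noncomputable def partialT {N : ℕ} (h : E N → ℝ → ℝ) (x : E N) (t : ℝ) : ℝ :=
  deriv (h x) t

/-- `|g(x, t)| ≤ a₁ |t|^(p-1) + a₂ |t|^(q-1)` for a.e. `x` and all `t`,
for some `a₁, a₂ > 0` and some `q ≥ p`. -/
def HasGrowth {N : ℕ} (p : ℝ) (g : E N → ℝ → ℝ) : Prop :=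
  ∃ a₁ a₂ q : ℝ, 0 < a₁ ∧ 0 < a₂ ∧ p ≤ q ∧
    ∀ᵐ x ∂(volume : Measure (E N)), ∀ t : ℝ,
      |g x t| ≤ a₁ * |t| ^ (p - 1) + a₂ * |t| ^ (q - 1)

/-- `G` is a weak (distributional) gradient of `u` on `ℝ^N`. -/
structure IsWeakGradient {N : ℕ} (u : E N → ℝ) (G : E N → E N) : Prop where
  locallyIntegrable : LocallyIntegrable u volume
  locallyIntegrable_grad : LocallyIntegrable G volume
  integral_eq : ∀ φ : E N → ℝ, ContDiff ℝ ∞ φ → HasCompactSupport φ → ∀ i : Fin N,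
    ∫ x, u x * fderiv ℝ φ x (EuclideanSpace.single i 1) = - ∫ x, G x i * φ x

/-- `u ∈ W^{1,p}(ℝ^N)`. -/
def MemSobolev {N : ℕ} (p : ℝ) (u : E N → ℝ) : Prop :=
  MemLp u (ENNReal.ofReal p) volume ∧
    ∃ G : E N → E N, MemLp G (ENNReal.ofReal p) volume ∧ IsWeakGradient u G

/-- `u ∈ W_V^{1,p}(ℝ^N) ∩ L^∞(ℝ^N)`. -/
structure MemX {N : ℕ} (p : ℝ) (V : E N → ℝ) (u : E N → ℝ) : Prop where
  memSobolev : MemSobolev p u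
  integrable_weight : Integrable (fun x => V x * |u x| ^ p) volume
  memLp_top : MemLp u ∞ volume

/-! ### Auxiliary facts, used only to see that `X` is a normed space -/

section aux

variable {N : ℕ} {p : ℝ} {V : E N → ℝ}

lemma IsPotential.ae_pos (hV : IsPotential V) : ∀ᵐ x, 0 < V x := by
  have h := hV.essInf_pos
  rw [essInf, Filter.liminf_eq] at h
  have hne : {a : ℝ | ∀ᶠ x in ae (volume : Measure (E N)), a ≤ V x}.Nonempty := by
    by_contra hne
    rw [Set.not_nonempty_iff_eq_empty] at hne
    rw [hne, Real.sSup_empty] at h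
    exact lt_irrefl _ h
  obtain ⟨a, ha, ha0⟩ := exists_lt_of_lt_csSup hne h
  filter_upwards [ha] with x hx using ha0.trans_le hx

lemma locallyIntegrable_coord {F : E N → E N} (hF : LocallyIntegrable F volume) (i : Fin N) :
    LocallyIntegrable (fun x => F x i) volume := fun x => by
  obtain ⟨s, hs, hF⟩ := hF x
  exact ⟨s, hs, (EuclideanSpace.proj i : E N →L[ℝ] ℝ).integrable_comp hF⟩

lemma IsWeakGradient.ae_unique {u : E N → ℝ} {G H : E N → E N}
    (hG : IsWeakGradient u G) (hH : IsWeakGradient u H) : G =ᵐ[volume] H := by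
  have key : ∀ i : Fin N, ∀ᵐ x, G x i = H x i := by
    intro i
    refine ae_eq_of_integral_contDiff_smul_eq
      (locallyIntegrable_coord hG.locallyIntegrable_grad i)
      (locallyIntegrable_coord hH.locallyIntegrable_grad i) fun φ hφ hc => ?_
    have h1 := hG.integral_eq φ hφ hc i
    have h2 := hH.integral_eq φ hφ hc i
    simp only [smul_eq_mul, mul_comm (φ _)]
    linarith
  filter_upwards [ae_all_iff.2 key] with x hx
  ext i
  exact hx i

lemma IsWeakGradient.congr_left {u v : E N → ℝ} {G : E N → E N}
    (hG : IsWeakGradient u G) (h : u =ᵐ[volume] v) : IsWeakGradient v G where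
  locallyIntegrable := hG.locallyIntegrable.congr h
  locallyIntegrable_grad := hG.locallyIntegrable_grad
  integral_eq φ hφ hc i := by
    rw [← hG.integral_eq φ hφ hc i]
    refine integral_congr_ae ?_
    filter_upwards [h] with x hx
    rw [hx]

lemma integrable_mul_of_contDiff {f ψ : E N → ℝ} (hf : LocallyIntegrable f volume)
    (hψ : Continuous ψ) (hc : HasCompactSupport ψ) :
    Integrable (fun x => f x * ψ x) volume := by
  simpa [mul_comm] using hf.integrable_smul_left_of_hasCompactSupport hψ hc

lemma continuous_fderiv_apply {φ : E N → ℝ} (hφ : ContDiff ℝ ∞ φ) (v : E N) :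
    Continuous fun x => fderiv ℝ φ x v :=
  (hφ.continuous_fderiv (by simp)).clm_apply continuous_const

lemma IsWeakGradient.add {u v : E N → ℝ} {G H : E N → E N}
    (hG : IsWeakGradient u G) (hH : IsWeakGradient v H) : IsWeakGradient (u + v) (G + H) where
  locallyIntegrable := hG.locallyIntegrable.add hH.locallyIntegrable
  locallyIntegrable_grad := hG.locallyIntegrable_grad.add hH.locallyIntegrable_grad
  integral_eq φ hφ hc i := by
    have c1 := continuous_fderiv_apply hφ (EuclideanSpace.single i 1)
    have c2 : HasCompactSupport fun x => fderiv ℝ φ x (EuclideanSpace.single i 1) :=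
      hc.fderiv_apply ℝ _
    simp only [Pi.add_apply, PiLp.add_apply, add_mul]
    rw [integral_add (integrable_mul_of_contDiff hG.locallyIntegrable c1 c2)
        (integrable_mul_of_contDiff hH.locallyIntegrable c1 c2),
      integral_add
        (integrable_mul_of_contDiff (locallyIntegrable_coord hG.locallyIntegrable_grad i)
          hφ.continuous hc)
        (integrable_mul_of_contDiff (locallyIntegrable_coord hH.locallyIntegrable_grad i)
          hφ.continuous hc),
      hG.integral_eq φ hφ hc i, hH.integral_eq φ hφ hc i]
    ring

lemma IsWeakGradient.smul {u : E N → ℝ} {G : E N → E N} (c : ℝ)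
    (hG : IsWeakGradient u G) : IsWeakGradient (c • u) (c • G) where
  locallyIntegrable := hG.locallyIntegrable.smul c
  locallyIntegrable_grad := hG.locallyIntegrable_grad.smul c
  integral_eq φ hφ hc i := by
    simp only [Pi.smul_apply, PiLp.smul_apply, smul_eq_mul, mul_assoc]
    rw [integral_const_mul, integral_const_mul, hG.integral_eq φ hφ hc i, mul_neg]

/-- The weighted function `V^(1/p) u`. -/
noncomputable def weighted (p : ℝ) (V u : E N → ℝ) (x : E N) : ℝ := V x ^ (1 / p) * u x

lemma weighted_rpow (hp : 1 < p) (hV : IsPotential V) (u : E N → ℝ) :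
    (fun x => ‖weighted p V u x‖ ^ p) =ᵐ[volume] fun x => V x * |u x| ^ p := by
  filter_upwards [hV.ae_pos] with x hx
  rw [weighted, norm_mul, Real.norm_eq_abs, Real.norm_eq_abs,
    abs_of_nonneg (Real.rpow_nonneg hx.le _),
    Real.mul_rpow (Real.rpow_nonneg hx.le _) (abs_nonneg _), ← Real.rpow_mul hx.le,
    one_div, inv_mul_cancel₀ (by linarith), Real.rpow_one]

lemma memLp_weighted_iff (hp : 1 < p) (hV : IsPotential V) {u : E N → ℝ}
    (hu : AEStronglyMeasurable u volume) :
    MemLp (weighted p V u) (ENNReal.ofReal p) volume ↔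
      Integrable (fun x => V x * |u x| ^ p) volume := by
  have hm : AEStronglyMeasurable (weighted p V u) volume :=
    ((hV.aemeasurable.pow_const _).mul hu.aemeasurable).aestronglyMeasurable
  rw [← integrable_congr (weighted_rpow hp hV u),
    ← integrable_norm_rpow_iff hm (by simp; linarith) ENNReal.ofReal_ne_top,
    ENNReal.toReal_ofReal (by linarith)]

lemma MemX.congr {u v : E N → ℝ} (hu : MemX p V u) (h : u =ᵐ[volume] v) : MemX p V v where
  memSobolev := by
    obtain ⟨h1, G, h2, h3⟩ := hu.memSobolev
    exact ⟨h1.ae_eq h, G, h2, h3.congr_left h⟩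
  integrable_weight := by
    refine hu.integrable_weight.congr ?_
    filter_upwards [h] with x hx
    rw [hx]
  memLp_top := hu.memLp_top.ae_eq h

lemma MemX.add (hp : 1 < p) (hV : IsPotential V) {u v : E N → ℝ} (hu : MemX p V u)
    (hv : MemX p V v) : MemX p V (u + v) where
  memSobolev := by
    obtain ⟨h1, G, h2, h3⟩ := hu.memSobolev
    obtain ⟨k1, H, k2, k3⟩ := hv.memSobolev
    exact ⟨h1.add k1, G + H, h2.add k2, h3.add k3⟩
  integrable_weight := by
    have h1 := (memLp_weighted_iff hp hV hu.memLp_top.1).2 hu.integrable_weight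
    have h2 := (memLp_weighted_iff hp hV hv.memLp_top.1).2 hv.integrable_weight
    refine (memLp_weighted_iff hp hV (hu.memLp_top.1.add hv.memLp_top.1)).1 ?_
    convert h1.add h2 using 1
    ext x
    simp [weighted, mul_add]
  memLp_top := hu.memLp_top.add hv.memLp_top

lemma MemX.smul (hp : 1 < p) (hV : IsPotential V) {u : E N → ℝ} (c : ℝ) (hu : MemX p V u) :
    MemX p V (c • u) where
  memSobolev := by
    obtain ⟨h1, G, h2, h3⟩ := hu.memSobolev
    exact ⟨h1.const_smul c, c • G, h2.const_smul c, h3.smul c⟩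
  integrable_weight := by
    have h1 := (memLp_weighted_iff hp hV hu.memLp_top.1).2 hu.integrable_weight
    refine (memLp_weighted_iff hp hV (hu.memLp_top.1.const_smul c)).1 ?_
    convert h1.const_smul c using 1
    ext x
    simp [weighted]
    ring
  memLp_top := hu.memLp_top.const_smul c

lemma MemX.zero (hp : 1 < p) : MemX p V (0 : E N → ℝ) where
  memSobolev := ⟨MemLp.zero, 0, MemLp.zero,
    ⟨(integrable_zero _ _ _).locallyIntegrable, (integrable_zero _ _ _).locallyIntegrable,
      by simp⟩⟩
  integrable_weight := by
    simp [Real.zero_rpow (by linarith : p ≠ 0)]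
  memLp_top := MemLp.zero

end aux

/-! ### The space `X = W_V^{1,p}(ℝ^N) ∩ L^∞(ℝ^N)` -/

/-- The linear space `W_V^{1,p}(ℝ^N) ∩ L^∞(ℝ^N)` of classes of a.e. equal functions. -/
def submoduleX {N : ℕ} {p : ℝ} {V : E N → ℝ} (hp : 1 < p) (hV : IsPotential V) :
    Submodule ℝ (E N →ₘ[volume] ℝ) where
  carrier := {u | MemX p V u}
  add_mem' {u v} hu hv :=
    (MemX.add hp hV hu hv).congr (AEEqFun.coeFn_add u v).symm
  zero_mem' := (MemX.zero hp).congr AEEqFun.coeFn_zero.symm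
  smul_mem' c u hu := (MemX.smul hp hV c hu).congr (AEEqFun.coeFn_smul c u).symm

/-- The space `X = W_V^{1,p}(ℝ^N) ∩ L^∞(ℝ^N)`. -/
def X {N : ℕ} {p : ℝ} {V : E N → ℝ} (hp : 1 < p) (hV : IsPotential V) : Type :=
  submoduleX hp hV

namespace X

section

variable {N : ℕ} {p : ℝ} {V : E N → ℝ} {hp : 1 < p} {hV : IsPotential V}

noncomputable instance : AddCommGroup (X hp hV) := inferInstanceAs (AddCommGroup (submoduleX hp hV))

noncomputable instance : Module ℝ (X hp hV) := inferInstanceAs (Module ℝ (submoduleX hp hV))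

/-- An element of `X` as a function (a representative of its class). -/
noncomputable instance : CoeFun (X hp hV) fun _ => E N → ℝ := ⟨fun u => (u.1 : E N → ℝ)⟩

lemma memX (u : X hp hV) : MemX p V u := u.2

/-- (A representative of) the weak gradient `∇u ∈ L^p(ℝ^N; ℝ^N)` of `u ∈ X`. -/
noncomputable def grad (u : X hp hV) : E N → E N := u.memX.memSobolev.2.choose

lemma memLp_grad (u : X hp hV) : MemLp u.grad (ENNReal.ofReal p) volume :=
  u.memX.memSobolev.2.choose_spec.1

lemma isWeakGradient_grad (u : X hp hV) : IsWeakGradient u u.grad :=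
  u.memX.memSobolev.2.choose_spec.2

/-- `‖u‖_V = (∫ |∇u|^p + ∫ V |u|^p)^(1/p)`. -/
noncomputable def normV (u : X hp hV) : ℝ :=
  ((∫ x, ‖u.grad x‖ ^ p) + ∫ x, V x * |u x| ^ p) ^ (1 / p)

/-- `|u|_∞ = ess sup |u|`. -/
noncomputable def normInfty (u : X hp hV) : ℝ := (eLpNorm u ∞ volume).toReal

/-- `‖u‖_X = ‖u‖_V + |u|_∞`. -/
noncomputable instance : Norm (X hp hV) := ⟨fun u => u.normV + u.normInfty⟩

lemma norm_def (u : X hp hV) : ‖u‖ = u.normV + u.normInfty := rfl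

lemma coe_add (u v : X hp hV) : (u + v : X hp hV) =ᵐ[volume] fun x => u x + v x :=
  AEEqFun.coeFn_add u.1 v.1

lemma coe_smul (c : ℝ) (u : X hp hV) : (c • u : X hp hV) =ᵐ[volume] fun x => c * u x :=
  AEEqFun.coeFn_smul c u.1

lemma grad_add (u v : X hp hV) : (u + v).grad =ᵐ[volume] u.grad + v.grad :=
  (u + v).isWeakGradient_grad.ae_unique
    ((u.isWeakGradient_grad.add v.isWeakGradient_grad).congr_left (coe_add u v).symm)

lemma grad_smul (c : ℝ) (u : X hp hV) : (c • u).grad =ᵐ[volume] c • u.grad :=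
  (c • u).isWeakGradient_grad.ae_unique
    ((u.isWeakGradient_grad.smul c).congr_left (coe_smul c u).symm)

lemma memLp_weighted (u : X hp hV) : MemLp (weighted p V u) (ENNReal.ofReal p) volume :=
  (memLp_weighted_iff hp hV u.memX.memLp_top.1).2 u.memX.integrable_weight

lemma integral_rpow_eq {F : Type*} [NormedAddCommGroup F] {f : E N → F} (hp : 1 < p)
    (hf : MemLp f (ENNReal.ofReal p) volume) :
    ∫ x, ‖f x‖ ^ p = (eLpNorm f (ENNReal.ofReal p) volume).toReal ^ p := by
  rw [hf.eLpNorm_eq_integral_rpow_norm (by simp; linarith) ENNReal.ofReal_ne_top,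
    ENNReal.toReal_ofReal (by linarith : 0 ≤ p)]
  have h0 : 0 ≤ ∫ x, ‖f x‖ ^ p := integral_nonneg fun x => Real.rpow_nonneg (norm_nonneg _) _
  rw [ENNReal.toReal_ofReal (Real.rpow_nonneg h0 _), ← Real.rpow_mul h0,
    inv_mul_cancel₀ (by linarith), Real.rpow_one]

/-- `‖u‖_V` as an `ℓ^p` combination of two `L^p` norms. -/
lemma normV_eq (u : X hp hV) : u.normV =
    ((eLpNorm u.grad (ENNReal.ofReal p) volume).toReal ^ p
      + (eLpNorm (weighted p V u) (ENNReal.ofReal p) volume).toReal ^ p) ^ (1 / p) := by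
  rw [normV, integral_rpow_eq hp u.memLp_grad, ← integral_rpow_eq hp u.memLp_weighted,
    integral_congr_ae (weighted_rpow hp hV u)]

lemma normV_nonneg (u : X hp hV) : 0 ≤ u.normV := by
  rw [normV_eq]
  positivity

lemma normInfty_nonneg (u : X hp hV) : 0 ≤ u.normInfty := ENNReal.toReal_nonneg

lemma eLpNorm_add_toReal_le {F : Type*} [NormedAddCommGroup F] {q : ℝ≥0∞} {f g h : E N → F}
    (hq : 1 ≤ q) (hf : MemLp f q volume) (hg : MemLp g q volume) (hh : h =ᵐ[volume] f + g) :
    (eLpNorm h q volume).toReal ≤ (eLpNorm f q volume).toReal + (eLpNorm g q volume).toReal := by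
  rw [eLpNorm_congr_ae hh, ← ENNReal.toReal_add hf.2.ne hg.2.ne]
  exact ENNReal.toReal_mono (ENNReal.add_ne_top.2 ⟨hf.2.ne, hg.2.ne⟩)
    (eLpNorm_add_le hf.1 hg.1 hq)

lemma normV_add_le (u v : X hp hV) : (u + v).normV ≤ u.normV + v.normV := by
  have hq : (1 : ℝ≥0∞) ≤ ENNReal.ofReal p := by simpa using hp.le
  have h1 := eLpNorm_add_toReal_le hq u.memLp_grad v.memLp_grad (grad_add u v)
  have hw : weighted p V (u + v : X hp hV) =ᵐ[volume] weighted p V u + weighted p V v := by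
    filter_upwards [coe_add u v] with x hx
    simp [weighted, hx, mul_add]
  have h2 := eLpNorm_add_toReal_le hq u.memLp_weighted v.memLp_weighted hw
  rw [normV_eq, normV_eq, normV_eq]
  have key := Real.Lp_add_le_of_nonneg (s := Finset.univ) (p := p)
    (f := ![(eLpNorm u.grad (ENNReal.ofReal p) volume).toReal,
      (eLpNorm (weighted p V u) (ENNReal.ofReal p) volume).toReal])
    (g := ![(eLpNorm v.grad (ENNReal.ofReal p) volume).toReal,
      (eLpNorm (weighted p V v) (ENNReal.ofReal p) volume).toReal]) hp.le
    (by intro i _; fin_cases i <;> simp) (by intro i _; fin_cases i <;> simp)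
  simp only [Fin.sum_univ_two, Matrix.cons_val_zero, Matrix.cons_val_one] at key
  refine le_trans ?_ key
  have hp0 : (0 : ℝ) ≤ p := by linarith
  gcongr

lemma normInfty_add_le (u v : X hp hV) : (u + v).normInfty ≤ u.normInfty + v.normInfty :=
  eLpNorm_add_toReal_le le_top u.memX.memLp_top v.memX.memLp_top (coe_add u v)

lemma normV_smul (c : ℝ) (u : X hp hV) : (c • u).normV = |c| * u.normV := by
  have hp0 : p ≠ 0 := by linarith
  have h1 : ∫ x, ‖(c • u).grad x‖ ^ p = |c| ^ p * ∫ x, ‖u.grad x‖ ^ p := by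
    rw [← integral_const_mul]
    refine integral_congr_ae ?_
    filter_upwards [grad_smul c u] with x hx
    rw [hx, Pi.smul_apply, norm_smul, Real.norm_eq_abs,
      Real.mul_rpow (abs_nonneg _) (norm_nonneg _)]
  have h2 : ∫ x, V x * |(c • u) x| ^ p = |c| ^ p * ∫ x, V x * |u x| ^ p := by
    rw [← integral_const_mul]
    refine integral_congr_ae ?_
    filter_upwards [coe_smul c u] with x hx
    rw [hx, abs_mul, Real.mul_rpow (abs_nonneg _) (abs_nonneg _)]
    ring
  have h3 : 0 ≤ (∫ x, ‖u.grad x‖ ^ p) + ∫ x, V x * |u x| ^ p := by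
    refine add_nonneg (integral_nonneg fun x => Real.rpow_nonneg (norm_nonneg _) _)
      (integral_nonneg_of_ae ?_)
    filter_upwards [hV.ae_pos] with x hx
    exact mul_nonneg hx.le (Real.rpow_nonneg (abs_nonneg _) _)
  rw [normV, h1, h2, ← mul_add, Real.mul_rpow (Real.rpow_nonneg (abs_nonneg _) _) h3,
    ← Real.rpow_mul (abs_nonneg _), mul_one_div_cancel hp0, Real.rpow_one, normV]

lemma normInfty_smul (c : ℝ) (u : X hp hV) : (c • u).normInfty = |c| * u.normInfty := by
  have h : (c • u : X hp hV) =ᵐ[volume] c • (u : E N → ℝ) := coe_smul c u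
  rw [normInfty, eLpNorm_congr_ae h, eLpNorm_const_smul, ENNReal.toReal_mul, normInfty]
  simp

lemma eq_zero_of_normInfty (u : X hp hV) (h : u.normInfty = 0) : u = 0 := by
  have h0 : eLpNorm u ∞ volume = 0 :=
    ((ENNReal.toReal_eq_zero_iff _).1 h).resolve_right u.memX.memLp_top.2.ne
  have h1 := (eLpNorm_eq_zero_iff u.memX.memLp_top.1 ENNReal.top_ne_zero).1 h0
  exact Subtype.ext (AEEqFun.ext (h1.trans AEEqFun.coeFn_zero.symm))

lemma normedSpaceCore : NormedSpace.Core ℝ (X hp hV) where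
  norm_nonneg u := add_nonneg u.normV_nonneg u.normInfty_nonneg
  norm_smul c u := by
    rw [norm_def, norm_def, normV_smul, normInfty_smul, Real.norm_eq_abs, mul_add]
  norm_triangle u v := by
    rw [norm_def, norm_def, norm_def]
    linarith [normV_add_le u v, normInfty_add_le u v]
  norm_eq_zero_iff u := by
    constructor
    · intro h
      rw [norm_def] at h
      exact eq_zero_of_normInfty u (by linarith [u.normV_nonneg, u.normInfty_nonneg])
    · rintro rfl
      rw [norm_def, ← zero_smul ℝ (0 : X hp hV), normV_smul, normInfty_smul]
      simp

noncomputable instance : NormedAddCommGroup (X hp hV) :=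
  NormedAddCommGroup.ofCore normedSpaceCore

noncomputable instance : NormedSpace ℝ (X hp hV) :=
  NormedSpace.ofCore normedSpaceCore

end

end X

/-! ### The functional -/

section functional

variable {N : ℕ} {p : ℝ} {V : E N → ℝ} {hp : 1 < p} {hV : IsPotential V}

/-- `G(x, t) = ∫_0^t g(x, s) ds`. -/
noncomputable def primitive (g : E N → ℝ → ℝ) (x : E N) (t : ℝ) : ℝ := ∫ s in (0 : ℝ)..t, g x s

/-- `J(u) = (1/p) ∫ A(x,u) |∇u|^p + (1/p) ∫ V |u|^p - ∫ G(x,u)`. -/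
noncomputable def energy (A g : E N → ℝ → ℝ) (u : X hp hV) : ℝ :=
  1 / p * (∫ x, A x (u x) * ‖u.grad x‖ ^ p) + 1 / p * (∫ x, V x * |u x| ^ p)
    - ∫ x, primitive g x (u x)

/-- `⟨dJ(u), v⟩ = ∫ A(x,u) |∇u|^(p-2) ∇u·∇v + (1/p) ∫ A_t(x,u) v |∇u|^p
  + ∫ V |u|^(p-2) u v - ∫ g(x,u) v`. -/
noncomputable def diffEnergy (A g : E N → ℝ → ℝ) (u v : X hp hV) : ℝ :=
  (∫ x, A x (u x) * ‖u.grad x‖ ^ (p - 2) * inner ℝ (u.grad x) (v.grad x))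
    + 1 / p * (∫ x, partialT A x (u x) * v x * ‖u.grad x‖ ^ p)
    + (∫ x, V x * |u x| ^ (p - 2) * u x * v x)
    - ∫ x, g x (u x) * v x

/-- All the integrals in `energy A g u` and in `diffEnergy A g u v` converge absolutely. -/
structure IntegralsConverge (A g : E N → ℝ → ℝ) (u v : X hp hV) : Prop where
  energy_A : Integrable (fun x => A x (u x) * ‖u.grad x‖ ^ p) volume
  energy_V : Integrable (fun x => V x * |u x| ^ p) volume
  energy_G : Integrable (fun x => primitive g x (u x)) volume
  diff_A : Integrable
    (fun x => A x (u x) * ‖u.grad x‖ ^ (p - 2) * inner ℝ (u.grad x) (v.grad x)) volume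
  diff_At : Integrable (fun x => partialT A x (u x) * v x * ‖u.grad x‖ ^ p) volume
  diff_V : Integrable (fun x => V x * |u x| ^ (p - 2) * u x * v x) volume
  diff_g : Integrable (fun x => g x (u x) * v x) volume

end functional

end WeightedSobolev

/-!
Each of the three integrals of `energy` is an action `∫ φ(x, z(x)) dx` of the field
`z = (u, V^(1/p) u, ∇u)`, which is of class `L^p` and has a bounded component `t = u`. The
differential of `φ` in `z` splits into a part `P` of growth `|z|^(p-1)` and a part `b` of growth
`|z|^p` acting only on the increment of `t`, both uniformly for bounded `t`. If fields converge in
`L^p` while their components `t` merely stay bounded, then along subsequences they converge a.e.,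
and by dominated convergence `P(·, z)` converges in `L^(p')` and `b(·, z)` in `L^1`. Hölder's
inequality, pairing `L^(p')` with the increments in `L^p` and `L^1` with those in `L^∞`, turns this
into norm convergence of the first variation. In particular the first variation is continuous on
`X`, so that directional derivatives, obtained by differentiation under the integral sign, are
enough for Fréchet differentiability.
-/

namespace WeightedSobolev

open scoped NNReal

/-! ### Superposition with Carathéodory functions -/

section Superposition

variable {α : Type*} {mα : MeasurableSpace α} {μ : Measure α}
variable {Z : Type*} [TopologicalSpace Z]
variable {F : Type*} [TopologicalSpace F] [TopologicalSpace.PseudoMetrizableSpace F]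

omit [TopologicalSpace Z] in
lemma aestronglyMeasurable_comp_simpleFunc {φ : α → Z → F}
    (hφ : ∀ z, AEStronglyMeasurable (fun x => φ x z) μ) (s : SimpleFunc α Z) :
    AEStronglyMeasurable (fun x => φ x (s x)) μ := by
  have hcover : ⋃ z : s.range, s ⁻¹' {z.1} = univ :=
    eq_univ_of_forall fun x => mem_iUnion.2 ⟨⟨s x, s.mem_range_self x⟩, rfl⟩
  rw [← Measure.restrict_univ (μ := μ), ← hcover, aestronglyMeasurable_iUnion_iff]
  intro z
  refine (hφ z).restrict.congr ?_
  filter_upwards [ae_restrict_mem (s.measurableSet_preimage {z.1})] with x (hx : s x = z)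
  rw [hx]

lemma aestronglyMeasurable_superposition {φ : α → Z → F}
    (hφ : ∀ z, AEStronglyMeasurable (fun x => φ x z) μ) (hφ_cont : ∀ᵐ x ∂μ, Continuous (φ x))
    {u : α → Z} (hu : AEStronglyMeasurable u μ) :
    AEStronglyMeasurable (fun x => φ x (u x)) μ := by
  let s := hu.stronglyMeasurable_mk.approx
  refine aestronglyMeasurable_of_tendsto_ae atTop (f := fun n x => φ x (s n x))
    (fun n => aestronglyMeasurable_comp_simpleFunc hφ (s n)) ?_
  filter_upwards [hφ_cont, hu.ae_eq_mk] with x hx hux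
  rw [hux]
  exact (hx.tendsto _).comp (hu.stronglyMeasurable_mk.tendsto_approx x)

end Superposition

section DominatedConvergence

variable {α : Type*} {mα : MeasurableSpace α} {μ : Measure α} {p r : ℝ≥0∞}
variable {F G : Type*} [NormedAddCommGroup F] [NormedAddCommGroup G]

lemma tendsto_eLpNorm_zero_of_dominated (hr0 : r ≠ 0) (hr : r ≠ ⊤) {f : ℕ → α → F} {b : α → ℝ}
    (hf : ∀ n, AEStronglyMeasurable (f n) μ) (hb : MemLp b r μ)
    (hle : ∀ n, ∀ᵐ x ∂μ, ‖f n x‖ ≤ b x)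
    (hlim : ∀ᵐ x ∂μ, Tendsto (fun n => f n x) atTop (𝓝 0)) :
    Tendsto (fun n => eLpNorm (f n) r μ) atTop (𝓝 0) := by
  have hr_pos : 0 < r.toReal := ENNReal.toReal_pos hr0 hr
  have hint : Tendsto (fun n => ∫⁻ x, ‖f n x‖ₑ ^ r.toReal ∂μ) atTop (𝓝 (∫⁻ _, 0 ∂μ)) := by
    refine tendsto_lintegral_of_dominated_convergence' (fun x => ‖b x‖ₑ ^ r.toReal)
      (fun n => (hf n).enorm.pow_const _) (fun n => ?_)
      (lintegral_rpow_enorm_lt_top_of_eLpNorm_lt_top hr0 hr hb.2).ne ?_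
    · filter_upwards [hle n] with x hx
      gcongr
      exact enorm_le_iff_norm_le.2 (hx.trans (le_abs_self _))
    · filter_upwards [hlim] with x hx
      have h := (hx.enorm).ennrpow_const r.toReal
      rwa [enorm_zero, ENNReal.zero_rpow_of_pos hr_pos] at h
  rw [lintegral_zero] at hint
  simp only [eLpNorm_eq_lintegral_rpow_enorm_toReal hr0 hr]
  have h := hint.ennrpow_const (1 / r.toReal)
  rwa [ENNReal.zero_rpow_of_pos (one_div_pos.2 hr_pos)] at h

/- Truncating `f n` at height `b` leaves a dominated sequence and an error at most `c n`. -/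
lemma tendsto_eLpNorm_zero_of_le_add (hr1 : 1 ≤ r) (hr : r ≠ ⊤) {f : ℕ → α → F}
    {b : α → ℝ} {c : ℕ → α → ℝ} (hf : ∀ n, AEStronglyMeasurable (f n) μ) (hb : MemLp b r μ)
    (hb0 : ∀ x, 0 ≤ b x)
    (hc : ∀ n, AEStronglyMeasurable (c n) μ) (hc0 : ∀ n x, 0 ≤ c n x)
    (hle : ∀ n, ∀ᵐ x ∂μ, ‖f n x‖ ≤ b x + c n x)
    (hc_lim : Tendsto (fun n => eLpNorm (c n) r μ) atTop (𝓝 0))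
    (hlim : ∀ᵐ x ∂μ, Tendsto (fun n => f n x) atTop (𝓝 0)) :
    Tendsto (fun n => eLpNorm (f n) r μ) atTop (𝓝 0) := by
  let t : ℕ → α → ℝ := fun n x => min ‖f n x‖ (b x)
  have ht_meas : ∀ n, AEStronglyMeasurable (t n) μ := fun n => (hf n).norm.inf hb.1
  have ht : Tendsto (fun n => eLpNorm (t n) r μ) atTop (𝓝 0) := by
    refine tendsto_eLpNorm_zero_of_dominated (zero_lt_one.trans_le hr1).ne' hr ht_meas hb
      (fun n => ae_of_all _ fun x => ?_) ?_
    · rw [Real.norm_of_nonneg (le_min (norm_nonneg _) (hb0 x))]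
      exact min_le_right _ _
    · filter_upwards [hlim] with x hx
      simpa [min_eq_left (hb0 x)] using hx.norm.min (tendsto_const_nhds (x := b x))
  refine tendsto_of_tendsto_of_tendsto_of_le_of_le tendsto_const_nhds
    (by simpa using ht.add hc_lim) (fun n => zero_le) fun n => ?_
  refine (eLpNorm_mono_ae_real ?_).trans (eLpNorm_add_le (ht_meas n) (hc n) hr1)
  filter_upwards [hle n] with x hx
  rcases min_cases ‖f n x‖ (b x) with ⟨h, -⟩ | ⟨h, -⟩
  · simpa only [Pi.add_apply, t, h] using le_add_of_nonneg_right (hc0 n x)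
  · simpa only [Pi.add_apply, t, h] using hx

lemma memLp_of_norm_le_rpow {s C : ℝ} (hs : 0 < s) (hsr : ENNReal.ofReal s * r = p)
    {f : α → F} {g : α → G} (hf : MemLp f p μ) (hg : AEStronglyMeasurable g μ)
    (hle : ∀ᵐ x ∂μ, ‖g x‖ ≤ C * ‖f x‖ ^ s) : MemLp g r μ := by
  have h := hf.norm_rpow_div (ENNReal.ofReal s)
  rw [ENNReal.toReal_ofReal hs.le, ← hsr,
    ENNReal.mul_div_right_comm, ENNReal.div_self (ENNReal.ofReal_pos.2 hs).ne'
      ENNReal.ofReal_ne_top, one_mul] at h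
  exact (h.const_mul C).mono' hg hle

lemma norm_sub_le_of_norm_le_rpow {s C : ℝ} (hs : 0 ≤ s) (hC : 0 ≤ C) {y y' : F} {w w' : G}
    (hw : ‖w‖ ≤ C * ‖y‖ ^ s) (hw' : ‖w'‖ ≤ C * ‖y'‖ ^ s) :
    ‖w' - w‖ ≤ 2 * C * 2 ^ s * (‖y‖ ^ s + ‖y' - y‖ ^ s) := by
  set m := max ‖y‖ ‖y' - y‖
  have hy' : ‖y'‖ ≤ 2 * m := by
    linarith [norm_le_norm_add_norm_sub' y' y, le_max_left ‖y‖ ‖y' - y‖,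
      le_max_right ‖y‖ ‖y' - y‖]
  have hm : m ^ s ≤ ‖y‖ ^ s + ‖y' - y‖ ^ s := by
    have h0 : 0 ≤ ‖y‖ ^ s := by positivity
    have h1 : 0 ≤ ‖y' - y‖ ^ s := by positivity
    rcases max_choice ‖y‖ ‖y' - y‖ with h | h <;> simp only [m, h] <;> linarith
  calc ‖w' - w‖ ≤ C * ‖y'‖ ^ s + C * ‖y‖ ^ s := (norm_sub_le _ _).trans (add_le_add hw' hw)
    _ ≤ C * (2 * m) ^ s + C * (2 * m) ^ s := by
        gcongr
        linarith [le_max_left ‖y‖ ‖y' - y‖, norm_nonneg y]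
    _ = 2 * C * 2 ^ s * m ^ s := by
        rw [Real.mul_rpow zero_le_two (le_max_of_le_left (norm_nonneg _))]; ring
    _ ≤ _ := by gcongr

lemma tendsto_eLpNorm_sub_of_norm_le_rpow {s C : ℝ} (hs : 0 < s) (hr1 : 1 ≤ r) (hr : r ≠ ⊤)
    (hsr : ENNReal.ofReal s * r = p) (hC : 0 ≤ C) {f : α → F} {fn : ℕ → α → F}
    (hf : MemLp f p μ) (hfn : ∀ n, AEStronglyMeasurable (fn n) μ)
    (hfn_lim : Tendsto (fun n => eLpNorm (fn n - f) p μ) atTop (𝓝 0))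
    {g : α → G} {gn : ℕ → α → G}
    (hg : AEStronglyMeasurable g μ) (hgn : ∀ n, AEStronglyMeasurable (gn n) μ)
    (hle : ∀ᵐ x ∂μ, ‖g x‖ ≤ C * ‖f x‖ ^ s) (hlen : ∀ n, ∀ᵐ x ∂μ, ‖gn n x‖ ≤ C * ‖fn n x‖ ^ s)
    (hlim : ∀ᵐ x ∂μ, Tendsto (fun n => gn n x) atTop (𝓝 (g x))) :
    Tendsto (fun n => eLpNorm (gn n - g) r μ) atTop (𝓝 0) := by
  set K := 2 * C * 2 ^ s
  have hrpow : ∀ h : α → F, eLpNorm (fun x => ‖h x‖ ^ s) r μ = eLpNorm h p μ ^ s := fun h => by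
    rw [eLpNorm_norm_rpow h hs, mul_comm, hsr]
  have hmeas : ∀ n, AEStronglyMeasurable (fun x => ‖(fn n - f) x‖ ^ s) μ := fun n =>
    (((hfn n).sub hf.1).norm.aemeasurable.pow_const s).aestronglyMeasurable
  refine tendsto_eLpNorm_zero_of_le_add hr1 hr (b := fun x => K * ‖f x‖ ^ s)
    (c := fun n x => K * ‖(fn n - f) x‖ ^ s) (fun n => (hgn n).sub hg) ?_
    (fun x => by positivity) (fun n => (hmeas n).const_mul K) (fun n x => by positivity) ?_ ?_ ?_
  · exact (memLp_of_norm_le_rpow hs hsr hf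
      (hf.1.norm.aemeasurable.pow_const s).aestronglyMeasurable (C := 1)
      (ae_of_all _ fun x => by rw [Real.norm_of_nonneg (by positivity), one_mul])).const_mul K
  · intro n
    filter_upwards [hle, hlen n] with x hx hxn
    rw [← mul_add]
    exact norm_sub_le_of_norm_le_rpow hs.le hC hx hxn
  · have h := ENNReal.Tendsto.const_mul (hfn_lim.ennrpow_const s)
      (Or.inr (enorm_ne_top (x := K)))
    rw [ENNReal.zero_rpow_of_pos hs, mul_zero] at h
    refine h.congr fun n => ?_
    rw [← hrpow, ← eLpNorm_const_smul]
    rfl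
  · filter_upwards [hlim] with x hx
    simpa using hx.sub_const (g x)

end DominatedConvergence

section LineDerivative

variable {Y F : Type*} [NormedAddCommGroup Y] [NormedSpace ℝ Y]
  [NormedAddCommGroup F] [NormedSpace ℝ F]

lemma hasFDerivAt_of_hasLineDerivAt_of_continuousAt {f : Y → F} {f' : Y → Y →L[ℝ] F} {y : Y}
    (hf : ∀ᶠ z in 𝓝 y, ∀ v, HasLineDerivAt ℝ f (f' z v) z v) (hf' : ContinuousAt f' y) :
    HasFDerivAt f (f' y) y := by
  refine HasFDerivAt.of_isLittleO (Asymptotics.isLittleO_iff.2 fun ε hε => ?_)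
  obtain ⟨δ, hδ, hball⟩ := Metric.eventually_nhds_iff_ball.1
    (hf.and (Metric.continuousAt_iff'.1 hf' ε hε))
  filter_upwards [Metric.ball_mem_nhds y hδ] with z hz
  set v := z - y
  have hseg : ∀ t ∈ Icc (0 : ℝ) 1, y + t • v ∈ Metric.ball y δ := fun t ht =>
    (convex_ball y δ).add_smul_sub_mem (Metric.mem_ball_self hδ) hz ht
  have hderiv : ∀ t ∈ Icc (0 : ℝ) 1,
      HasDerivWithinAt (fun t : ℝ => f (y + t • v) - t • f' y v) (f' (y + t • v) v - f' y v)
        (Icc 0 1) t := fun t ht => by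
    have h := ((hball _ (hseg t ht)).1 v).scomp_of_eq t ((hasDerivAt_id t).sub_const t) (by simp)
    refine HasDerivAt.hasDerivWithinAt (.sub ?_ ?_)
    · refine (h.congr_of_eventuallyEq (.of_forall fun s => ?_)).congr_deriv (one_smul ..)
      simp [add_assoc, ← add_smul]
    · simpa using (hasDerivAt_id t).smul_const (f' y v)
  have hmvt := norm_image_sub_le_of_norm_deriv_le_segment_01' (C := ε * ‖v‖) hderiv fun t ht => by
    rw [← sub_apply]
    refine (ContinuousLinearMap.le_opNorm _ _).trans ?_
    gcongr
    exact (dist_eq_norm (f' (y + t • v)) (f' y) ▸ (hball _ (hseg t (Ico_subset_Icc_self ht))).2).le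
  simpa [v, sub_right_comm] using hmvt

end LineDerivative

section CaratheodoryGrowth

variable {α : Type*} {mα : MeasurableSpace α} {μ : Measure α}
variable {T W : Type*} [NormedAddCommGroup T] [NormedAddCommGroup W]
variable {F : Type*} [NormedAddCommGroup F]

/-- A Carathéodory integrand `φ(x, z)` of the variable `z = (t, w)` whose growth in `z` is of
order `s`, uniformly as long as the component `t` stays bounded. This is the class of integrands
that can be evaluated on fields `z` of class `L^p` with `t` of class `L^∞`. -/
structure CaratheodoryGrowth (μ : Measure α) (s : ℝ) (φ : α → T × W → F) : Prop where
  aestronglyMeasurable : ∀ z, AEStronglyMeasurable (fun x => φ x z) μ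
  ae_continuous : ∀ᵐ x ∂μ, Continuous (φ x)
  exists_bound : ∀ ρ : ℝ, ∃ C : ℝ≥0, ∀ᵐ x ∂μ, ∀ z, ‖z.1‖ ≤ ρ → ‖φ x z‖ ≤ C * ‖z‖ ^ s

namespace CaratheodoryGrowth

variable {s : ℝ} {φ : α → T × W → F}

lemma of_continuous {ψ : T × W → F} (hψ : Continuous ψ) {C : ℝ≥0}
    (hC : ∀ z, ‖ψ z‖ ≤ C * ‖z‖ ^ s) : CaratheodoryGrowth μ s fun _ => ψ where
  aestronglyMeasurable _ := aestronglyMeasurable_const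
  ae_continuous := ae_of_all _ fun _ => hψ
  exists_bound _ := ⟨C, ae_of_all _ fun _ z _ => hC z⟩

lemma of_fst (hs : 0 ≤ s) {f : α → T → F} (hf : ∀ t, AEStronglyMeasurable (fun x => f x t) μ)
    (hf_cont : ∀ᵐ x ∂μ, Continuous (f x))
    (hbound : ∀ ρ : ℝ, ∃ C : ℝ≥0, ∀ᵐ x ∂μ, ∀ t, ‖t‖ ≤ ρ → ‖f x t‖ ≤ C * ‖t‖ ^ s) :
    CaratheodoryGrowth μ s fun x (z : T × W) => f x z.1 where
  aestronglyMeasurable z := hf z.1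
  ae_continuous := by
    filter_upwards [hf_cont] with x hx using hx.comp continuous_fst
  exists_bound ρ := by
    obtain ⟨C, hC⟩ := hbound ρ
    refine ⟨C, ?_⟩
    filter_upwards [hC] with x hx z hz
    refine (hx z.1 hz).trans ?_
    gcongr
    exact norm_fst_le z

lemma aestronglyMeasurable_comp (hφ : CaratheodoryGrowth μ s φ) {z : α → T × W}
    (hz : AEStronglyMeasurable z μ) : AEStronglyMeasurable (fun x => φ x (z x)) μ :=
  aestronglyMeasurable_superposition hφ.aestronglyMeasurable hφ.ae_continuous hz

variable {p r : ℝ≥0∞} {ρ : ℝ}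

lemma memLp (hφ : CaratheodoryGrowth μ s φ) (hs : 0 < s) (hsr : ENNReal.ofReal s * r = p)
    {z : α → T × W} (hz : MemLp z p μ) (hzρ : ∀ᵐ x ∂μ, ‖(z x).1‖ ≤ ρ) :
    MemLp (fun x => φ x (z x)) r μ := by
  obtain ⟨C, hC⟩ := hφ.exists_bound ρ
  refine memLp_of_norm_le_rpow hs hsr hz (hφ.aestronglyMeasurable_comp hz.1) (C := C) ?_
  filter_upwards [hC, hzρ] with x hx hxρ using hx (z x) hxρ

lemma tendsto_eLpNorm_sub (hφ : CaratheodoryGrowth μ s φ) (hs : 0 < s) (hr1 : 1 ≤ r)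
    (hr : r ≠ ⊤) (hsr : ENNReal.ofReal s * r = p) {z : α → T × W} {zn : ℕ → α → T × W}
    (hz : MemLp z p μ) (hzn : ∀ n, AEStronglyMeasurable (zn n) μ)
    (hzρ : ∀ᵐ x ∂μ, ‖(z x).1‖ ≤ ρ) (hznρ : ∀ n, ∀ᵐ x ∂μ, ‖(zn n x).1‖ ≤ ρ)
    (hlim : Tendsto (fun n => eLpNorm (zn n - z) p μ) atTop (𝓝 0)) :
    Tendsto (fun n => eLpNorm ((fun x => φ x (zn n x)) - fun x => φ x (z x)) r μ)
      atTop (𝓝 0) := by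
  have hp0 : p ≠ 0 :=
    hsr ▸ mul_ne_zero (ENNReal.ofReal_pos.2 hs).ne' (zero_lt_one.trans_le hr1).ne'
  obtain ⟨C, hC⟩ := hφ.exists_bound ρ
  refine tendsto_of_subseq_tendsto fun ns hns => ?_
  obtain ⟨ms, hms, hae⟩ := (tendstoInMeasure_of_tendsto_eLpNorm hp0 (fun n => hzn (ns n)) hz.1
    (hlim.comp hns)).exists_seq_tendsto_ae
  refine ⟨ms, tendsto_eLpNorm_sub_of_norm_le_rpow hs hr1 hr hsr C.2 hz (fun n => hzn (ns (ms n)))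
    (hlim.comp (hns.comp hms.tendsto_atTop)) (hφ.aestronglyMeasurable_comp hz.1)
    (fun n => hφ.aestronglyMeasurable_comp (hzn _)) ?_ (fun n => ?_) ?_⟩
  · filter_upwards [hC, hzρ] with x hx hxρ using hx (z x) hxρ
  · filter_upwards [hC, hznρ (ns (ms n))] with x hx hxρ using hx _ hxρ
  · filter_upwards [hφ.ae_continuous, hae] with x hx hxlim using (hx.tendsto _).comp hxlim

variable {G H : Type*} [NormedAddCommGroup G] [NormedAddCommGroup H]
  [NormedSpace ℝ F] [NormedSpace ℝ G] [NormedSpace ℝ H]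

lemma bilin (B : F →L[ℝ] G →L[ℝ] H) {s' : ℝ} (hs : 0 ≤ s) (hs' : 0 ≤ s') {ψ : α → T × W → G}
    (hφ : CaratheodoryGrowth μ s φ) (hψ : CaratheodoryGrowth μ s' ψ) :
    CaratheodoryGrowth μ (s + s') fun x z => B (φ x z) (ψ x z) where
  aestronglyMeasurable z :=
    B.aestronglyMeasurable_comp₂ (hφ.aestronglyMeasurable z) (hψ.aestronglyMeasurable z)
  ae_continuous := by
    filter_upwards [hφ.ae_continuous, hψ.ae_continuous] with x hx hx'
    exact (B.continuous.comp hx).clm_apply hx'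
  exists_bound ρ := by
    obtain ⟨C, hC⟩ := hφ.exists_bound ρ
    obtain ⟨C', hC'⟩ := hψ.exists_bound ρ
    refine ⟨‖B‖₊ * C * C', ?_⟩
    filter_upwards [hC, hC'] with x hx hx' z hz
    calc ‖B (φ x z) (ψ x z)‖ ≤ ‖B‖ * ‖φ x z‖ * ‖ψ x z‖ := B.le_opNorm₂ _ _
      _ ≤ ‖B‖ * (C * ‖z‖ ^ s) * (C' * ‖z‖ ^ s') := by gcongr <;> [exact hx z hz; exact hx' z hz]
      _ = _ := by
        rw [Real.rpow_add_of_nonneg (norm_nonneg z) hs hs']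
        push_cast
        ring

end CaratheodoryGrowth

end CaratheodoryGrowth

/-! ### Actions of Lagrangians along fields -/

section Exponents

variable (p : ℝ) [Fact (1 < p)]

instance fact_one_le_ofReal : Fact (1 ≤ ENNReal.ofReal p) :=
  ⟨ENNReal.one_le_ofReal.2 (Fact.out : 1 < p).le⟩

instance holderConjugate_ofReal_conjExponent :
    ENNReal.HolderConjugate (ENNReal.ofReal p.conjExponent) (ENNReal.ofReal p) :=
  (Real.HolderConjugate.conjExponent Fact.out).symm.ennrealOfReal

instance fact_one_le_ofReal_conjExponent : Fact (1 ≤ ENNReal.ofReal p.conjExponent) :=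
  ⟨ENNReal.HolderConjugate.one_le _ (ENNReal.ofReal p)⟩

lemma ofReal_sub_one_mul_ofReal_conjExponent :
    ENNReal.ofReal (p - 1) * ENNReal.ofReal p.conjExponent = ENNReal.ofReal p := by
  have hp : 1 < p := Fact.out
  rw [← ENNReal.ofReal_mul (sub_nonneg.2 hp.le),
    (Real.HolderConjugate.conjExponent hp).sub_one_mul_conj]

lemma exponent_pos : 0 < p := zero_lt_one.trans Fact.out

end Exponents

section FieldMap

variable {α : Type*} {mα : MeasurableSpace α}
variable {Y : Type*} [NormedAddCommGroup Y] [NormedSpace ℝ Y]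
variable {T W : Type*} [NormedAddCommGroup T] [NormedSpace ℝ T]
  [NormedAddCommGroup W] [NormedSpace ℝ W]
variable {F : Type*} [NormedAddCommGroup F]

variable (Y T W) in
/-- A continuous linear map attaching to each `y` a field `(t, w)` of class `L^p` whose component
`t` is also of class `L^∞`; `toLinfty` records `t` as an element of `L^∞`. The model is the jet
`(u, ∇u)` of a function `u` of class `W^{1,p} ∩ L^∞`. -/
structure FieldMap (p : ℝ≥0∞) (μ : Measure α) [Fact (1 ≤ p)] where
  toLp : Y →L[ℝ] Lp (T × W) p μ
  toLinfty : Y →L[ℝ] Lp T ⊤ μ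
  toLinfty_ae_eq : ∀ y, ∀ᵐ x ∂μ, toLinfty y x = (toLp y x).1

namespace FieldMap

variable {p : ℝ≥0∞} {μ : Measure α} [Fact (1 ≤ p)] (J : FieldMap Y T W p μ)

lemma ae_norm_fst_le (y : Y) : ∀ᵐ x ∂μ, ‖(J.toLp y x).1‖ ≤ ‖J.toLinfty y‖ := by
  have h := ae_le_lpNorm_exponent_top (Lp.memLp (J.toLinfty y))
  filter_upwards [J.toLinfty_ae_eq y, h] with x hx hle
  rw [← hx, Lp.norm_def, toReal_eLpNorm (Lp.aestronglyMeasurable _)]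
  exact hle

lemma toLp_add_smul_ae_eq (y v : Y) (c : ℝ) :
    ∀ᵐ x ∂μ, J.toLp (y + c • v) x = J.toLp y x + c • J.toLp v x := by
  rw [map_add, map_smul]
  filter_upwards [Lp.coeFn_add (J.toLp y) (c • J.toLp v), Lp.coeFn_smul c (J.toLp v)]
    with x h₁ h₂
  rw [h₁, Pi.add_apply, h₂, Pi.smul_apply]

end FieldMap

namespace CaratheodoryGrowth

variable {μ : Measure α} {p r : ℝ≥0∞} [Fact (1 ≤ p)] {s : ℝ} {φ : α → T × W → F}

lemma memLp_comp (hφ : CaratheodoryGrowth μ s φ) (hs : 0 < s) (hsr : ENNReal.ofReal s * r = p)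
    (J : FieldMap Y T W p μ) (y : Y) : MemLp (fun x => φ x (J.toLp y x)) r μ :=
  hφ.memLp hs hsr (Lp.memLp _) (J.ae_norm_fst_le y)

/-- The superposition (Nemytskii) operator `y ↦ φ(·, J y)` with values in `L^r`. -/
noncomputable def superposition (hφ : CaratheodoryGrowth μ s φ) (hs : 0 < s)
    (hsr : ENNReal.ofReal s * r = p) (J : FieldMap Y T W p μ) (y : Y) : Lp F r μ :=
  (hφ.memLp_comp hs hsr J y).toLp _

lemma coeFn_superposition (hφ : CaratheodoryGrowth μ s φ) (hs : 0 < s)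
    (hsr : ENNReal.ofReal s * r = p) (J : FieldMap Y T W p μ) (y : Y) :
    hφ.superposition hs hsr J y =ᵐ[μ] fun x => φ x (J.toLp y x) :=
  (hφ.memLp_comp hs hsr J y).coeFn_toLp

lemma tendsto_superposition (hφ : CaratheodoryGrowth μ s φ) (hs : 0 < s) [Fact (1 ≤ r)]
    (hr : r ≠ ⊤) (hsr : ENNReal.ofReal s * r = p) {J : FieldMap Y T W p μ} {y : Y} {yn : ℕ → Y}
    {M : ℝ} (hyn : ∀ n, ‖J.toLinfty (yn n)‖ ≤ M)
    (hlim : Tendsto (fun n => J.toLp (yn n)) atTop (𝓝 (J.toLp y))) :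
    Tendsto (fun n => hφ.superposition hs hsr J (yn n)) atTop
      (𝓝 (hφ.superposition hs hsr J y)) := by
  have hle : ∀ v, ‖J.toLinfty v‖ ≤ max M ‖J.toLinfty y‖ →
      ∀ᵐ x ∂μ, ‖(J.toLp v x).1‖ ≤ max M ‖J.toLinfty y‖ := fun v hv => by
    filter_upwards [J.ae_norm_fst_le v] with x hx using hx.trans hv
  refine (Lp.tendsto_Lp_iff_tendsto_eLpNorm'' _ _ _ _).2 ?_
  exact hφ.tendsto_eLpNorm_sub hs Fact.out hr hsr (Lp.memLp _) (fun n => Lp.aestronglyMeasurable _)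
    (hle y (le_max_right _ _)) (fun n => hle _ (le_max_of_le_left (hyn n)))
    ((Lp.tendsto_Lp_iff_tendsto_eLpNorm' _ _).1 hlim)

end CaratheodoryGrowth

end FieldMap

section Lagrangian

variable {α : Type*} {mα : MeasurableSpace α} {μ : Measure α}
variable {Y : Type*} [NormedAddCommGroup Y] [NormedSpace ℝ Y]
variable {T W : Type*} [NormedAddCommGroup T] [NormedSpace ℝ T]
  [NormedAddCommGroup W] [NormedSpace ℝ W]

variable (T W) in
/-- A Lagrangian `φ(x, z)` of growth `p` in `z = (t, w)` whose differential in `z` splits as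
`P(x, z) + b(x, z) ∘ fst` with `P` of growth `p - 1` and `b` of growth `p`: the part `b`, which is
only integrable along fields `z` of class `L^p`, is paired with the bounded component `t`. The
functions `φ`, `P` and `b` are the fields `density`, `regular` and `singular`. -/
structure Lagrangian (μ : Measure α) (p : ℝ) where
  density : α → T × W → ℝ
  regular : α → T × W → T × W →L[ℝ] ℝ
  singular : α → T × W → T →L[ℝ] ℝ
  growth : CaratheodoryGrowth μ p density
  growth_regular : CaratheodoryGrowth μ (p - 1) regular
  growth_singular : CaratheodoryGrowth μ p singular
  hasFDerivAt : ∀ᵐ x ∂μ, ∀ z, HasFDerivAt (density x) (regular x z + singular x z ∘L .fst ℝ T W) z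

namespace Lagrangian

/-- The differential of the density in `z`. -/
noncomputable def differential {p : ℝ} (ℒ : Lagrangian T W μ p) (x : α) (z : T × W) :
    T × W →L[ℝ] ℝ :=
  ℒ.regular x z + ℒ.singular x z ∘L .fst ℝ T W

variable {p : ℝ} [Fact (1 < p)] (ℒ : Lagrangian T W μ p)
  (J : FieldMap Y T W (ENNReal.ofReal p) μ)

lemma integrable (y : Y) : Integrable (fun x => ℒ.density x (J.toLp y x)) μ :=
  memLp_one_iff_integrable.1 (ℒ.growth.memLp_comp (exponent_pos p) (mul_one _) J y)

lemma integrable_regular (y v : Y) :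
    Integrable (fun x => ℒ.regular x (J.toLp y x) (J.toLp v x)) μ :=
  memLp_one_iff_integrable.1 <| (ContinuousLinearMap.id ℝ (T × W →L[ℝ] ℝ)).memLp_of_bilin 1
    (ℒ.growth_regular.memLp_comp (sub_pos.2 Fact.out) (ofReal_sub_one_mul_ofReal_conjExponent p)
      J y) (Lp.memLp (J.toLp v))

lemma integrable_singular (y v : Y) :
    Integrable (fun x => ℒ.singular x (J.toLp y x) (J.toLp v x).1) μ := by
  have hb := (ContinuousLinearMap.id ℝ (T →L[ℝ] ℝ)).memLp_of_bilin 1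
    (ℒ.growth_singular.memLp_comp (exponent_pos p) (mul_one _) J y) (Lp.memLp (J.toLinfty v))
  refine (memLp_one_iff_integrable.1 hb).congr ?_
  filter_upwards [J.toLinfty_ae_eq v] with x hx
  rw [hx, ContinuousLinearMap.id_apply]

/-- The functional `y ↦ ∫ φ(x, J y)`. -/
noncomputable def action (y : Y) : ℝ := ∫ x, ℒ.density x (J.toLp y x) ∂μ

/-- The first variation `v ↦ ∫ P(x, J y) (J v) + ∫ b(x, J y) (J v).1` of the action at `y`. -/
noncomputable def firstVariation (y : Y) : Y →L[ℝ] ℝ :=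
  (ContinuousLinearMap.id ℝ (T × W →L[ℝ] ℝ)).lpPairing μ (ENNReal.ofReal p.conjExponent)
      (ENNReal.ofReal p) (ℒ.growth_regular.superposition (sub_pos.2 Fact.out)
        (ofReal_sub_one_mul_ofReal_conjExponent p) J y) ∘L J.toLp
    + (ContinuousLinearMap.id ℝ (T →L[ℝ] ℝ)).lpPairing μ 1 ⊤
        (ℒ.growth_singular.superposition (exponent_pos p) (mul_one _) J y) ∘L J.toLinfty

lemma firstVariation_apply (y v : Y) :
    ℒ.firstVariation J y v = ∫ x, ℒ.regular x (J.toLp y x) (J.toLp v x) ∂μ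
      + ∫ x, ℒ.singular x (J.toLp y x) (J.toLp v x).1 ∂μ := by
  rw [firstVariation, add_apply, ContinuousLinearMap.comp_apply, ContinuousLinearMap.comp_apply,
    ContinuousLinearMap.lpPairing_eq_integral, ContinuousLinearMap.lpPairing_eq_integral]
  congr 1 <;> refine integral_congr_ae ?_
  · filter_upwards [ℒ.growth_regular.coeFn_superposition (sub_pos.2 Fact.out)
      (ofReal_sub_one_mul_ofReal_conjExponent p) J y] with x hx
    rw [hx, ContinuousLinearMap.id_apply]
  · filter_upwards [J.toLinfty_ae_eq v, ℒ.growth_singular.coeFn_superposition (exponent_pos p)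
      (mul_one _) J y] with x hv hx
    rw [hv, hx, ContinuousLinearMap.id_apply]

variable {J} {y : Y} {yn : ℕ → Y} {M : ℝ}

lemma tendsto_action (hyn : ∀ n, ‖J.toLinfty (yn n)‖ ≤ M)
    (hlim : Tendsto (fun n => J.toLp (yn n)) atTop (𝓝 (J.toLp y))) :
    Tendsto (fun n => ℒ.action J (yn n)) atTop (𝓝 (ℒ.action J y)) := by
  have hL := ℒ.growth.tendsto_superposition (exponent_pos p) ENNReal.one_ne_top (mul_one _) hyn hlim
  have haction : ∀ v, ℒ.action J v =
      ∫ x, ℒ.growth.superposition (exponent_pos p) (mul_one _) J v x ∂μ := fun v =>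
    integral_congr_ae (ℒ.growth.coeFn_superposition _ _ J v).symm
  simp only [haction]
  exact (continuous_integral.tendsto _).comp hL

lemma tendsto_firstVariation (hyn : ∀ n, ‖J.toLinfty (yn n)‖ ≤ M)
    (hlim : Tendsto (fun n => J.toLp (yn n)) atTop (𝓝 (J.toLp y))) :
    Tendsto (fun n => ℒ.firstVariation J (yn n)) atTop (𝓝 (ℒ.firstVariation J y)) := by
  have hP := ℒ.growth_regular.tendsto_superposition (sub_pos.2 Fact.out) ENNReal.ofReal_ne_top
    (ofReal_sub_one_mul_ofReal_conjExponent p) hyn hlim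
  have hb := ℒ.growth_singular.tendsto_superposition (exponent_pos p) ENNReal.one_ne_top
    (mul_one _) hyn hlim
  have hpP := (((ContinuousLinearMap.id ℝ (T × W →L[ℝ] ℝ)).lpPairing μ
    (ENNReal.ofReal p.conjExponent) (ENNReal.ofReal p)).continuous.tendsto _).comp hP
  have hpb := (((ContinuousLinearMap.id ℝ (T →L[ℝ] ℝ)).lpPairing μ 1 ⊤).continuous.tendsto _).comp
    hb
  exact (((ContinuousLinearMap.precomp ℝ J.toLp).continuous.tendsto _).comp hpP).add
    (((ContinuousLinearMap.precomp ℝ J.toLinfty).continuous.tendsto _).comp hpb)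

lemma continuous_firstVariation : Continuous (ℒ.firstVariation J) := by
  refine continuous_iff_seqContinuous.2 fun yn y hlim => ?_
  obtain ⟨M, hM⟩ := ((J.toLinfty.continuous.tendsto y).comp hlim).norm.bddAbove_range
  exact ℒ.tendsto_firstVariation (fun n => hM (mem_range_self n))
    ((J.toLp.continuous.tendsto y).comp hlim)

lemma exists_norm_differential_le (ρ : ℝ) : ∃ C : ℝ, ∀ᵐ x ∂μ, ∀ z ζ : T × W,
    ‖z.1‖ ≤ ρ → ‖ζ.1‖ ≤ ρ → ∀ m, ‖z‖ ≤ m → ‖ζ‖ ≤ m →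
      ‖ℒ.differential x z ζ‖ ≤ C * m ^ p := by
  have hp : 1 < p := Fact.out
  obtain ⟨C, hC⟩ := ℒ.growth_regular.exists_bound ρ
  obtain ⟨C', hC'⟩ := ℒ.growth_singular.exists_bound ρ
  refine ⟨C + C' * ρ, ?_⟩
  filter_upwards [hC, hC'] with x hP hb z ζ hz hζ m hzm hζm
  have hm : 0 ≤ m := (norm_nonneg z).trans hzm
  calc ‖ℒ.differential x z ζ‖ ≤ ‖ℒ.regular x z‖ * ‖ζ‖ + ‖ℒ.singular x z‖ * ‖ζ.1‖ :=
        (norm_add_le _ _).trans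
          (add_le_add ((ℒ.regular x z).le_opNorm ζ) ((ℒ.singular x z).le_opNorm ζ.1))
    _ ≤ C * m ^ (p - 1) * m + C' * m ^ p * ρ := by
        gcongr
        · exact (hP z hz).trans (by gcongr)
        · exact (hb z hz).trans (by gcongr)
    _ = (C + C' * ρ) * m ^ p := by
        rw [mul_assoc, ← Real.rpow_add_one' hm (by linarith), sub_add_cancel]
        ring

variable (J)

lemma exists_integrable_bound (y v : Y) : ∃ B : α → ℝ, Integrable B μ ∧
    ∀ᵐ x ∂μ, ∀ c ∈ Metric.ball (0 : ℝ) 1,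
      ‖ℒ.differential x (J.toLp y x + c • J.toLp v x) (J.toLp v x)‖ ≤ B x := by
  obtain ⟨C, hC⟩ := ℒ.exists_norm_differential_le (‖J.toLinfty y‖ + ‖J.toLinfty v‖)
  refine ⟨fun x => C * ‖‖J.toLp y x‖ + ‖J.toLp v x‖‖ ^ p, Integrable.const_mul ?_ C, ?_⟩
  · have hsum := (Lp.memLp (J.toLp y)).norm.add (Lp.memLp (J.toLp v)).norm
    simpa only [Pi.add_apply, ENNReal.toReal_ofReal (exponent_pos p).le]
      using hsum.integrable_norm_rpow (ENNReal.ofReal_pos.2 (exponent_pos p)).ne'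
        ENNReal.ofReal_ne_top
  · filter_upwards [hC, J.ae_norm_fst_le y, J.ae_norm_fst_le v] with x hx hy hv c hc
    have hc' : ‖c‖ ≤ 1 := (mem_ball_zero_iff.1 hc).le
    refine hx _ _ ?_ (hv.trans (le_add_of_nonneg_left (norm_nonneg _))) _ ?_ ?_
    · exact (norm_add_le _ _).trans
        (add_le_add hy ((norm_smul_le c (J.toLp v x).1).trans
          ((mul_le_of_le_one_left (norm_nonneg _) hc').trans hv)))
    · refine ((norm_add_le _ _).trans (add_le_add_right ?_ _)).trans (le_abs_self _)
      exact (norm_smul_le _ _).trans (mul_le_of_le_one_left (norm_nonneg _) hc')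
    · exact (le_add_of_nonneg_left (norm_nonneg _)).trans (le_abs_self _)

lemma hasLineDerivAt_action (y v : Y) :
    HasLineDerivAt ℝ (ℒ.action J) (ℒ.firstVariation J y v) y v := by
  have hline (c : ℝ) : (fun x => ℒ.density x (J.toLp (y + c • v) x))
      =ᵐ[μ] fun x => ℒ.density x (J.toLp y x + c • J.toLp v x) := by
    filter_upwards [J.toLp_add_smul_ae_eq y v c] with x hx
    rw [hx]
  obtain ⟨B, hB, hle⟩ := ℒ.exists_integrable_bound J y v
  have hderiv : ∀ᵐ x ∂μ, ∀ c ∈ Metric.ball (0 : ℝ) 1,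
      HasDerivAt (fun c => ℒ.density x (J.toLp y x + c • J.toLp v x))
        (ℒ.differential x (J.toLp y x + c • J.toLp v x) (J.toLp v x)) c := by
    filter_upwards [ℒ.hasFDerivAt] with x hx c _
    refine (hx _).comp_hasDerivAt c ?_
    simpa only [id, one_smul] using
      ((hasDerivAt_id c).smul_const (J.toLp v x)).const_add (J.toLp y x)
  have hint := (ℒ.integrable_regular J y v).add (ℒ.integrable_singular J y v)
  have h0 := (hasDerivAt_integral_of_dominated_loc_of_deriv_le
    (Metric.ball_mem_nhds (0 : ℝ) one_pos)
    (.of_forall fun c => (ℒ.integrable J (y + c • v)).1.congr (hline c))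
    ((ℒ.integrable J (y + (0 : ℝ) • v)).congr (hline 0))
    (by simpa using! hint.1) hle hB hderiv).2
  refine (h0.congr_deriv ?_).congr_of_eventuallyEq (.of_forall fun c => integral_congr_ae (hline c))
  rw [firstVariation_apply, ← integral_add (ℒ.integrable_regular J y v)
    (ℒ.integrable_singular J y v)]
  simp [differential]

lemma hasFDerivAt_action (y : Y) : HasFDerivAt (ℒ.action J) (ℒ.firstVariation J y) y :=
  hasFDerivAt_of_hasLineDerivAt_of_continuousAt (.of_forall (ℒ.hasLineDerivAt_action J))
    ℒ.continuous_firstVariation.continuousAt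

end Lagrangian

end Lagrangian

section NormRpow

variable {α : Type*} {mα : MeasurableSpace α} {μ : Measure α}
variable {T W : Type*} [NormedAddCommGroup T] [NormedSpace ℝ T]
  [NormedAddCommGroup W] [NormedSpace ℝ W]
variable {H : Type*} [NormedAddCommGroup H] [InnerProductSpace ℝ H]
variable {p : ℝ} [Fact (1 < p)]

lemma caratheodoryGrowth_norm_rpow (L : T × W →L[ℝ] H) :
    CaratheodoryGrowth μ p fun _ z => ‖L z‖ ^ p := by
  have hp : 0 ≤ p := (exponent_pos p).le
  refine .of_continuous (L.continuous.norm.rpow_const fun _ => Or.inr hp) (C := ‖L‖₊ ^ p)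
    fun z => ?_
  rw [Real.norm_of_nonneg (by positivity), NNReal.coe_rpow, coe_nnnorm,
    ← Real.mul_rpow (norm_nonneg L) (norm_nonneg z)]
  gcongr
  exact L.le_opNorm z

lemma caratheodoryGrowth_fderiv_norm_rpow (L : T × W →L[ℝ] H) :
    CaratheodoryGrowth μ (p - 1) fun _ z => fderiv ℝ (fun y : H => ‖y‖ ^ p) (L z) ∘L L := by
  have hp : 1 < p := Fact.out
  have hcont : Continuous (fderiv ℝ fun y : H => ‖y‖ ^ p) :=
    (contDiff_norm_rpow hp).continuous_fderiv one_ne_zero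
  refine .of_continuous ((hcont.comp L.continuous).clm_comp continuous_const)
    (C := p.toNNReal * ‖L‖₊ ^ p) fun z => ?_
  have hle : ‖fderiv ℝ (fun y : H => ‖y‖ ^ p) (L z)‖ ≤ p * ‖L z‖ ^ (p - 1) :=
    (norm_fderiv_norm_id_rpow (L z) hp).le
  calc ‖fderiv ℝ (fun y : H => ‖y‖ ^ p) (L z) ∘L L‖
      ≤ p * (‖L‖ * ‖z‖) ^ (p - 1) * ‖L‖ := by
        refine (ContinuousLinearMap.opNorm_comp_le _ _).trans ?_
        gcongr
        refine hle.trans ?_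
        gcongr
        exact L.le_opNorm z
    _ = _ := by
        have hL : ‖L‖ ^ (p - 1) * ‖L‖ = ‖L‖ ^ p := by
          rw [← Real.rpow_add_one' (norm_nonneg L) (by linarith), sub_add_cancel]
        rw [NNReal.coe_mul, Real.coe_toNNReal p (by linarith), NNReal.coe_rpow, coe_nnnorm, ← hL,
          Real.mul_rpow (norm_nonneg L) (norm_nonneg z)]
        ring

lemma hasFDerivAt_norm_rpow_comp (L : T × W →L[ℝ] H) (z : T × W) :
    HasFDerivAt (fun z => ‖L z‖ ^ p) (fderiv ℝ (fun y : H => ‖y‖ ^ p) (L z) ∘L L) z :=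
  ((contDiff_norm_rpow Fact.out).differentiable one_ne_zero _).hasFDerivAt.comp z L.hasFDerivAt

lemma fderiv_norm_rpow_comp_apply (L : T × W →L[ℝ] H) (z ζ : T × W) :
    (fderiv ℝ (fun y : H => ‖y‖ ^ p) (L z) ∘L L) ζ
      = p * (‖L z‖ ^ (p - 2) * inner ℝ (L z) (L ζ)) := by
  rw [ContinuousLinearMap.comp_apply, fderiv_norm_rpow _ Fact.out, smul_apply,
    innerSL_apply_apply, smul_eq_mul, mul_assoc]

namespace Lagrangian

/-- The Lagrangian `‖L z‖ ^ p` for a continuous linear map `L`. -/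
noncomputable def normRpow (L : T × W →L[ℝ] H) : Lagrangian T W μ p where
  density _ z := ‖L z‖ ^ p
  regular _ z := fderiv ℝ (fun y : H => ‖y‖ ^ p) (L z) ∘L L
  singular _ _ := 0
  growth := caratheodoryGrowth_norm_rpow L
  growth_regular := caratheodoryGrowth_fderiv_norm_rpow L
  growth_singular := .of_continuous continuous_const (C := 0) (by simp)
  hasFDerivAt := .of_forall fun _ z => by
    rw [ContinuousLinearMap.zero_comp, add_zero]
    exact hasFDerivAt_norm_rpow_comp L z

/-- The Lagrangian `a(x, t) ‖L z‖ ^ p`, `z = (t, w)`, with a coefficient `a` which is bounded for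
`t` in bounded sets, as is its derivative `a'` in `t`. -/
noncomputable def mulNormRpow {a : α → T → ℝ} {a' : α → T → T →L[ℝ] ℝ}
    (ha : CaratheodoryGrowth μ 0 fun x (z : T × W) => a x z.1)
    (ha' : CaratheodoryGrowth μ 0 fun x (z : T × W) => a' x z.1)
    (hderiv : ∀ᵐ x ∂μ, ∀ t, HasFDerivAt (a x) (a' x t) t) (L : T × W →L[ℝ] H) :
    Lagrangian T W μ p where
  density x z := a x z.1 * ‖L z‖ ^ p
  regular x z := a x z.1 • (fderiv ℝ (fun y : H => ‖y‖ ^ p) (L z) ∘L L)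
  singular x z := ‖L z‖ ^ p • a' x z.1
  growth := by
    simpa using ha.bilin (.mul ℝ ℝ) le_rfl (exponent_pos p).le (caratheodoryGrowth_norm_rpow L)
  growth_regular := by
    simpa using ha.bilin (.lsmul ℝ ℝ) le_rfl (sub_nonneg.2 (Fact.out : 1 < p).le)
      (caratheodoryGrowth_fderiv_norm_rpow L)
  growth_singular := by
    simpa using (caratheodoryGrowth_norm_rpow L).bilin (.lsmul ℝ ℝ) (exponent_pos p).le le_rfl ha'
  hasFDerivAt := by
    filter_upwards [hderiv] with x hx z
    exact ((hx z.1).comp z hasFDerivAt_fst).mul (hasFDerivAt_norm_rpow_comp L z)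

/-- The Lagrangian `f(x, t)`, `z = (t, w)`, depending on the bounded component only. -/
noncomputable def ofFst {f : α → T → ℝ} {f' : α → T → T →L[ℝ] ℝ}
    (hf : CaratheodoryGrowth μ p fun x (z : T × W) => f x z.1)
    (hf' : CaratheodoryGrowth μ (p - 1) fun x (z : T × W) => f' x z.1)
    (hderiv : ∀ᵐ x ∂μ, ∀ t, HasFDerivAt (f x) (f' x t) t) : Lagrangian T W μ p where
  density x z := f x z.1
  regular x z := f' x z.1 ∘L .fst ℝ T W
  singular _ _ := 0
  growth := hf
  growth_regular := by
    have hconst : CaratheodoryGrowth μ 0 fun _ (_ : T × W) => ContinuousLinearMap.fst ℝ T W :=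
      .of_continuous continuous_const (C := ‖ContinuousLinearMap.fst ℝ T W‖₊) (by simp)
    simpa using hf'.bilin (.compL ℝ (T × W) T ℝ) (sub_nonneg.2 (Fact.out : 1 < p).le) le_rfl hconst
  growth_singular := .of_continuous continuous_const (C := 0) (by simp)
  hasFDerivAt := by
    filter_upwards [hderiv] with x hx z
    rw [ContinuousLinearMap.zero_comp, add_zero]
    exact (hx z.1).comp z hasFDerivAt_fst

end Lagrangian

end NormRpow

/-! ### Coefficients of the energy -/

section Nonlinearity

variable {N : ℕ} {p : ℝ} {h g : E N → ℝ → ℝ}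

namespace IsCaratheodory

lemma ae_continuous {k : ℕ} (hh : IsCaratheodory k h) : ∀ᵐ x, Continuous (h x) := by
  filter_upwards [hh.contDiff] with x hx using hx.continuous

lemma ae_hasDerivAt (hh : IsCaratheodory 1 h) : ∀ᵐ x, ∀ t, HasDerivAt (h x) (partialT h x t) t := by
  filter_upwards [hh.contDiff] with x hx t
  exact (hx.differentiable one_ne_zero t).hasDerivAt

lemma partialT (hh : IsCaratheodory 1 h) : IsCaratheodory 0 (partialT h) where
  aemeasurable t := by
    have hlim : Tendsto (fun n : ℕ => 1 / ((n : ℝ) + 1)) atTop (𝓝[≠] 0) :=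
      tendsto_nhdsWithin_iff.2 ⟨tendsto_one_div_add_atTop_nhds_zero_nat,
        .of_forall fun n => Nat.one_div_pos_of_nat.ne'⟩
    refine aemeasurable_of_tendsto_metrizable_ae atTop
      (fun n : ℕ => ((hh.aemeasurable (t + 1 / ((n : ℝ) + 1))).sub (hh.aemeasurable t)).const_smul
        (1 / ((n : ℝ) + 1))⁻¹) ?_
    filter_upwards [hh.ae_hasDerivAt] with x hx
    exact (hasDerivAt_iff_tendsto_slope_zero.1 (hx t)).comp hlim
  contDiff := by
    filter_upwards [hh.contDiff] with x hx
    exact contDiff_zero.2 (hx.continuous_deriv le_rfl)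

lemma ae_hasDerivAt_primitive (hg : IsCaratheodory 0 g) :
    ∀ᵐ x, ∀ t, HasDerivAt (primitive g x) (g x t) t := by
  filter_upwards [hg.ae_continuous] with x hx t
  exact (hx.integral_hasStrictDerivAt 0 t).hasDerivAt

lemma primitive (hg : IsCaratheodory 0 g) : IsCaratheodory 0 (primitive g) where
  aemeasurable t := by
    have hint : ∀ ν : Measure ℝ, [SFinite ν] →
        AEStronglyMeasurable (fun x => ∫ s, g x s ∂ν) (volume : Measure (E N)) := fun ν _ => by
      refine AEStronglyMeasurable.integral_prod_right' (f := fun z : E N × ℝ => g z.1 z.2) ?_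
      exact aestronglyMeasurable_superposition (φ := fun z : E N × ℝ => g z.1)
        (fun s => (hg.aemeasurable s).aestronglyMeasurable.comp_fst)
        (Measure.quasiMeasurePreserving_fst.ae hg.ae_continuous)
        measurable_snd.aestronglyMeasurable
    exact ((hint _).sub (hint _)).aemeasurable
  contDiff := by
    filter_upwards [hg.ae_hasDerivAt_primitive] with x hx
    exact contDiff_zero.2 (continuous_iff_continuousAt.2 fun t => (hx t).continuousAt)

end IsCaratheodory

lemma LocallyEssBounded.exists_bound (hh : LocallyEssBounded h) (ρ : ℝ) :
    ∃ C : ℝ≥0, ∀ᵐ x, ∀ t, ‖t‖ ≤ ρ → ‖h x t‖ ≤ C := by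
  have hfin := (hh (max ρ 1) (lt_max_of_lt_right one_pos)).ne
  refine ⟨(essSup (fun x : E N => ⨆ t ∈ Icc (-max ρ 1) (max ρ 1), ‖h x t‖ₑ) volume).toNNReal, ?_⟩
  filter_upwards [ENNReal.ae_le_essSup
    (fun x : E N => ⨆ t ∈ Icc (-max ρ 1) (max ρ 1), ‖h x t‖ₑ)] with x hx t ht
  have ht' : t ∈ Icc (-max ρ 1) (max ρ 1) := abs_le.1 (ht.trans (le_max_left ρ 1))
  exact ENNReal.le_toNNReal_of_coe_le
    ((le_iSup₂ (f := fun t _ => ‖h x t‖ₑ) t ht').trans hx) hfin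

/-- `g(x, t) = O(|t|^(p-1))` uniformly in `x`, for `t` in any bounded set: the part of the power
growth condition `HasGrowth` that matters for bounded functions. -/
def HasLocalGrowth (p : ℝ) (g : E N → ℝ → ℝ) : Prop :=
  ∀ ρ : ℝ, ∃ C : ℝ≥0, ∀ᵐ x ∂(volume : Measure (E N)), ∀ t, ‖t‖ ≤ ρ → ‖g x t‖ ≤ C * ‖t‖ ^ (p - 1)

lemma HasGrowth.hasLocalGrowth (hp : 1 ≤ p) (hg : HasGrowth p g) : HasLocalGrowth p g := by
  obtain ⟨a₁, a₂, q, -, ha₂, hpq, hle⟩ := hg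
  refine fun ρ => ⟨(a₁ + a₂ * ρ ^ (q - p)).toNNReal, ?_⟩
  filter_upwards [hle] with x hx t ht
  calc ‖g x t‖ ≤ a₁ * ‖t‖ ^ (p - 1) + a₂ * ‖t‖ ^ (q - 1) := hx t
    _ = (a₁ + a₂ * ‖t‖ ^ (q - p)) * ‖t‖ ^ (p - 1) := by
        rw [← sub_add_sub_cancel q p 1, Real.rpow_add_of_nonneg (norm_nonneg t)
          (sub_nonneg.2 hpq) (sub_nonneg.2 hp)]
        ring
    _ ≤ (a₁ + a₂ * ρ ^ (q - p)) * ‖t‖ ^ (p - 1) := by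
        gcongr
    _ ≤ _ := by
        gcongr
        exact Real.le_coe_toNNReal _

lemma norm_primitive_le (hp : 1 ≤ p) {x : E N} {ρ : ℝ} {C : ℝ≥0}
    (hle : ∀ t, ‖t‖ ≤ ρ → ‖g x t‖ ≤ C * ‖t‖ ^ (p - 1)) {t : ℝ} (ht : ‖t‖ ≤ ρ) :
    ‖primitive g x t‖ ≤ C * ‖t‖ ^ p := by
  have hs : ∀ s ∈ uIoc 0 t, ‖g x s‖ ≤ C * ‖t‖ ^ (p - 1) := fun s hs => by
    have hst : ‖s‖ ≤ ‖t‖ := by simpa using abs_sub_left_of_mem_uIcc (uIoc_subset_uIcc hs)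
    refine (hle s (hst.trans ht)).trans ?_
    gcongr
  refine (intervalIntegral.norm_integral_le_of_norm_le_const hs).trans_eq ?_
  rw [sub_zero, ← Real.norm_eq_abs, mul_assoc, ← Real.rpow_add_one' (norm_nonneg t) (by linarith),
    sub_add_cancel]

end Nonlinearity

section CoefficientLagrangian

variable {N : ℕ} {p s : ℝ} {f g A : E N → ℝ → ℝ} {W : Type*} [NormedAddCommGroup W]

lemma IsCaratheodory.caratheodoryGrowth {k : ℕ} (hf : IsCaratheodory k f) (hs : 0 ≤ s)
    (hle : ∀ ρ : ℝ, ∃ C : ℝ≥0, ∀ᵐ x, ∀ t, ‖t‖ ≤ ρ → ‖f x t‖ ≤ C * ‖t‖ ^ s) :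
    CaratheodoryGrowth volume s fun x (z : ℝ × W) => f x z.1 :=
  .of_fst hs (fun t => (hf.aemeasurable t).aestronglyMeasurable) hf.ae_continuous hle

lemma IsCaratheodory.caratheodoryGrowth_zero {k : ℕ} (hf : IsCaratheodory k f)
    (hf_bdd : LocallyEssBounded f) :
    CaratheodoryGrowth volume 0 fun x (z : ℝ × W) => f x z.1 :=
  hf.caratheodoryGrowth le_rfl fun ρ => by
    simpa only [Real.rpow_zero, mul_one] using hf_bdd.exists_bound ρ

lemma caratheodoryGrowth_primitive (hp : 1 ≤ p) (hg : IsCaratheodory 0 g)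
    (hg_growth : HasLocalGrowth p g) :
    CaratheodoryGrowth volume p fun x (z : ℝ × W) => primitive g x z.1 := by
  refine hg.primitive.caratheodoryGrowth (zero_le_one.trans hp) fun ρ => ?_
  obtain ⟨C, hC⟩ := hg_growth ρ
  refine ⟨C, ?_⟩
  filter_upwards [hC] with x hx t ht using norm_primitive_le hp hx ht

lemma CaratheodoryGrowth.toSpanSingleton {α : Type*} {mα : MeasurableSpace α} {μ : Measure α}
    {T F : Type*} [NormedAddCommGroup T] [NormedAddCommGroup F] [NormedSpace ℝ F]
    {φ : α → T × W → F} (hφ : CaratheodoryGrowth μ s φ) :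
    CaratheodoryGrowth μ s fun x z => ContinuousLinearMap.toSpanSingleton ℝ (φ x z) where
  aestronglyMeasurable z :=
    (ContinuousLinearMap.toSpanSingletonLIE ℝ F).continuous.comp_aestronglyMeasurable
      (hφ.aestronglyMeasurable z)
  ae_continuous := by
    filter_upwards [hφ.ae_continuous] with x hx
    exact (ContinuousLinearMap.toSpanSingletonLIE ℝ F).continuous.comp hx
  exists_bound := by simpa only [ContinuousLinearMap.norm_toSpanSingleton] using hφ.exists_bound

variable [Fact (1 < p)] [NormedSpace ℝ W]

namespace Lagrangian

/-- The Lagrangian `A(x, t) ‖L z‖ ^ p`, `z = (t, w)`. -/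
noncomputable def principal (hA : IsCaratheodory 1 A) (hA_bdd : LocallyEssBounded A)
    (hAt_bdd : LocallyEssBounded (partialT A)) {H : Type*} [NormedAddCommGroup H]
    [InnerProductSpace ℝ H] (L : ℝ × W →L[ℝ] H) : Lagrangian ℝ W (volume : Measure (E N)) p :=
  mulNormRpow (hA.caratheodoryGrowth_zero hA_bdd)
    (hA.partialT.caratheodoryGrowth_zero hAt_bdd).toSpanSingleton hA.ae_hasDerivAt L

lemma principal_regular_apply (hA : IsCaratheodory 1 A) (hA_bdd : LocallyEssBounded A)
    (hAt_bdd : LocallyEssBounded (partialT A)) {H : Type*} [NormedAddCommGroup H]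
    [InnerProductSpace ℝ H] (L : ℝ × W →L[ℝ] H) (x : E N) (z ζ : ℝ × W) :
    (principal (p := p) hA hA_bdd hAt_bdd L).regular x z ζ
      = p * (A x z.1 * ‖L z‖ ^ (p - 2) * inner ℝ (L z) (L ζ)) :=
  (congrArg (A x z.1 * ·) (fderiv_norm_rpow_comp_apply L z ζ)).trans (by ring)

lemma principal_singular_apply (hA : IsCaratheodory 1 A) (hA_bdd : LocallyEssBounded A)
    (hAt_bdd : LocallyEssBounded (partialT A)) {H : Type*} [NormedAddCommGroup H]
    [InnerProductSpace ℝ H] (L : ℝ × W →L[ℝ] H) (x : E N) (z : ℝ × W) (t : ℝ) :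
    (principal (p := p) hA hA_bdd hAt_bdd L).singular x z t
      = partialT A x z.1 * t * ‖L z‖ ^ p :=
  show ‖L z‖ ^ p * (t * partialT A x z.1) = _ by ring

variable (W) in
/-- The Lagrangian `∫_0^t g(x, s) ds`, `z = (t, w)`. -/
noncomputable def ofPrimitive (hg : IsCaratheodory 0 g) (hg_growth : HasLocalGrowth p g) :
    Lagrangian ℝ W (volume : Measure (E N)) p :=
  ofFst (caratheodoryGrowth_primitive (Fact.out : 1 < p).le hg hg_growth)
    (hg.caratheodoryGrowth (sub_nonneg.2 (Fact.out : 1 < p).le) hg_growth).toSpanSingleton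
    hg.ae_hasDerivAt_primitive

lemma ofPrimitive_regular_apply (hg : IsCaratheodory 0 g) (hg_growth : HasLocalGrowth p g)
    (x : E N) (z ζ : ℝ × W) :
    (ofPrimitive W hg hg_growth).regular x z ζ = g x z.1 * ζ.1 :=
  mul_comm ζ.1 (g x z.1)

end Lagrangian

end CoefficientLagrangian

/-! ### The field attached to a function of `X` -/

lemma IsPotential.ae_essInf_le {N : ℕ} {V : E N → ℝ} (hV : IsPotential V) :
    ∀ᵐ x, essInf V volume ≤ V x :=
  _root_.ae_essInf_le ⟨0, hV.ae_pos.mono fun _ hx => hx.le⟩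

namespace X

variable {N : ℕ} {p : ℝ} {V : E N → ℝ}

section Norms

variable {hp : 1 < p} {hV : IsPotential V}

lemma normV_le_norm (u : X hp hV) : u.normV ≤ ‖u‖ := le_add_of_nonneg_right u.normInfty_nonneg

lemma normInfty_le_norm (u : X hp hV) : u.normInfty ≤ ‖u‖ := le_add_of_nonneg_left u.normV_nonneg

lemma lpNorm_grad_le (u : X hp hV) : lpNorm u.grad (ENNReal.ofReal p) volume ≤ u.normV := by
  rw [← toReal_eLpNorm u.memLp_grad.1, normV_eq, one_div,
    Real.le_rpow_inv_iff_of_pos ENNReal.toReal_nonneg (by positivity) (zero_lt_one.trans hp)]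
  exact le_add_of_nonneg_right (by positivity)

lemma lpNorm_weighted_le (u : X hp hV) :
    lpNorm (weighted p V u) (ENNReal.ofReal p) volume ≤ u.normV := by
  rw [← toReal_eLpNorm u.memLp_weighted.1, normV_eq, one_div,
    Real.le_rpow_inv_iff_of_pos ENNReal.toReal_nonneg (by positivity) (zero_lt_one.trans hp)]
  exact le_add_of_nonneg_left (by positivity)

end Norms

section Jet

variable {hp : 1 < p} {hV : IsPotential V}

/-- The field `(u, V^(1/p) u, ∇u)`, through which the integrands of `energy` depend on `u`. The
weight is absorbed in the second component, since `V` itself need not be bounded. -/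
noncomputable def jetField (u : X hp hV) (x : E N) : ℝ × ℝ × E N :=
  (u x, weighted p V u x, u.grad x)

lemma memLp_jetField (u : X hp hV) : MemLp u.jetField (ENNReal.ofReal p) volume :=
  memLp_prod_iff.2 ⟨u.memX.memSobolev.1, memLp_prod_iff.2 ⟨u.memLp_weighted, u.memLp_grad⟩⟩

lemma jetField_add (u v : X hp hV) : (u + v).jetField =ᵐ[volume] u.jetField + v.jetField := by
  filter_upwards [coe_add u v, grad_add u v] with x h h_grad
  simp [jetField, weighted, h, h_grad, mul_add]

lemma jetField_smul (c : ℝ) (u : X hp hV) : (c • u).jetField =ᵐ[volume] c • u.jetField := by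
  filter_upwards [coe_smul c u, grad_smul c u] with x h h_grad
  simp [jetField, weighted, h, h_grad, mul_left_comm]

variable (hp hV) in
lemma exists_norm_jetField_le : ∃ K : ℝ, 0 ≤ K ∧ ∀ u : X hp hV, ∀ᵐ x,
    ‖u.jetField x‖ ≤ K * ‖weighted p V u x‖ + ‖u.grad x‖ := by
  have hp0 : 0 < p := zero_lt_one.trans hp
  have hm : 0 < essInf V volume ^ (1 / p) := Real.rpow_pos_of_pos hV.essInf_pos _
  refine ⟨max (essInf V volume ^ (1 / p))⁻¹ 1, by positivity, fun u => ?_⟩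
  filter_upwards [hV.ae_essInf_le] with x hx
  have hweight : essInf V volume ^ (1 / p) ≤ V x ^ (1 / p) :=
    Real.rpow_le_rpow hV.essInf_pos.le hx (one_div_pos.2 hp0).le
  have hu : ‖u x‖ ≤ (essInf V volume ^ (1 / p))⁻¹ * ‖weighted p V u x‖ := by
    rw [inv_mul_eq_div, le_div_iff₀' hm, weighted, norm_mul,
      Real.norm_of_nonneg (hm.le.trans hweight)]
    gcongr
  refine max_le ?_ (max_le ?_ (le_add_of_nonneg_left (by positivity)))
  · refine (hu.trans ?_).trans (le_add_of_nonneg_right (norm_nonneg _))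
    gcongr
    exact le_max_left _ _
  · refine le_trans ?_ (le_add_of_nonneg_right (norm_nonneg _))
    exact le_mul_of_one_le_left (norm_nonneg _) (le_max_right _ _)

variable (hp hV) in
lemma exists_lpNorm_jetField_le : ∃ K : ℝ, 0 ≤ K ∧ ∀ u : X hp hV,
    lpNorm u.jetField (ENNReal.ofReal p) volume ≤ K * u.normV := by
  obtain ⟨K, hK, hle⟩ := exists_norm_jetField_le hp hV
  refine ⟨K + 1, by positivity, fun u => ?_⟩
  have hw := u.memLp_weighted.norm.const_mul K
  have hg := u.memLp_grad.norm
  calc lpNorm u.jetField (ENNReal.ofReal p) volume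
      ≤ lpNorm ((fun x => K * ‖weighted p V u x‖) + fun x => ‖u.grad x‖)
          (ENNReal.ofReal p) volume := by
        rw [← toReal_eLpNorm u.memLp_jetField.1, ← toReal_eLpNorm (hw.add hg).1]
        exact ENNReal.toReal_mono (hw.add hg).2.ne (eLpNorm_mono_ae_real (hle u))
    _ ≤ lpNorm (K • fun x => ‖weighted p V u x‖) (ENNReal.ofReal p) volume
          + lpNorm (fun x => ‖u.grad x‖) (ENNReal.ofReal p) volume :=
        lpNorm_add_le hw (ENNReal.one_le_ofReal.2 hp.le)
    _ = K * lpNorm (weighted p V u) (ENNReal.ofReal p) volume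
          + lpNorm u.grad (ENNReal.ofReal p) volume := by
        rw [lpNorm_const_smul, lpNorm_norm u.memLp_weighted.1, lpNorm_norm u.memLp_grad.1,
          coe_nnnorm, Real.norm_of_nonneg hK]
    _ ≤ K * u.normV + u.normV := by
        gcongr
        exacts [u.lpNorm_weighted_le, u.lpNorm_grad_le]
    _ = (K + 1) * u.normV := by ring

end Jet

section FieldMap

variable [hp : Fact (1 < p)] (hV : IsPotential V)

/-- The map `u ↦ (u, V^(1/p) u, ∇u)` on `X`, with `u` itself as the bounded component. -/
noncomputable def jet : FieldMap (X hp.out hV) ℝ (ℝ × E N) (ENNReal.ofReal p)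
    (volume : Measure (E N)) where
  toLp := LinearMap.mkContinuousOfExistsBound
    { toFun u := u.memLp_jetField.toLp u.jetField
      map_add' u v := (MemLp.toLp_congr _ _ (jetField_add u v)).trans (MemLp.toLp_add _ _)
      map_smul' c u :=
        (MemLp.toLp_congr _ _ (jetField_smul c u)).trans (MemLp.toLp_const_smul c _) } <| by
    obtain ⟨K, hK, hle⟩ := exists_lpNorm_jetField_le hp.out hV
    refine ⟨K, fun u => ?_⟩
    rw [LinearMap.coe_mk, AddHom.coe_mk, Lp.norm_toLp, toReal_eLpNorm u.memLp_jetField.1]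
    exact (hle u).trans (by gcongr; exact u.normV_le_norm)
  toLinfty := LinearMap.mkContinuous
    { toFun u := u.memX.memLp_top.toLp u
      map_add' u v := (MemLp.toLp_congr _ _ (coe_add u v)).trans (MemLp.toLp_add _ _)
      map_smul' c u := (MemLp.toLp_congr _ _ (coe_smul c u)).trans (MemLp.toLp_const_smul c _) } 1
    fun u => by
      rw [LinearMap.coe_mk, AddHom.coe_mk, Lp.norm_toLp, one_mul]
      exact u.normInfty_le_norm
  toLinfty_ae_eq u := by
    filter_upwards [u.memX.memLp_top.coeFn_toLp, u.memLp_jetField.coeFn_toLp] with x h h_jet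
    exact h.trans (congrArg Prod.fst h_jet).symm

lemma coeFn_jet (u : X hp.out hV) : (jet hV).toLp u =ᵐ[volume] u.jetField :=
  u.memLp_jetField.coeFn_toLp

lemma norm_jet_toLp (u : X hp.out hV) :
    ‖(jet hV).toLp u‖ = lpNorm u.jetField (ENNReal.ofReal p) volume :=
  (Lp.norm_toLp _ u.memLp_jetField).trans (toReal_eLpNorm u.memLp_jetField.1)

lemma norm_jet_toLinfty (u : X hp.out hV) : ‖(jet hV).toLinfty u‖ = u.normInfty :=
  Lp.norm_toLp _ u.memX.memLp_top

lemma tendsto_jet {un : ℕ → X hp.out hV} {u : X hp.out hV}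
    (hlim : Tendsto (fun n => (un n - u).normV) atTop (𝓝 0)) :
    Tendsto (fun n => (jet hV).toLp (un n)) atTop (𝓝 ((jet hV).toLp u)) := by
  obtain ⟨K, -, hle⟩ := exists_lpNorm_jetField_le hp.out hV
  refine tendsto_iff_norm_sub_tendsto_zero.2 (squeeze_zero (fun _ => norm_nonneg _)
    (fun n => ?_) (by simpa only [mul_zero] using hlim.const_mul K))
  rw [← map_sub, norm_jet_toLp]
  exact hle (un n - u)

end FieldMap

end X

/-! ### The energy -/

section Energy

open X

variable {N : ℕ} {p : ℝ} [hp : Fact (1 < p)] {V : E N → ℝ} {hV : IsPotential V}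
  {A g : E N → ℝ → ℝ}

lemma norm_weighted_rpow_mul_inner_weighted (u v : E N → ℝ) {x : E N} (hx : 0 < V x) :
    ‖weighted p V u x‖ ^ (p - 2) * inner ℝ (weighted p V u x) (weighted p V v x)
      = V x * |u x| ^ (p - 2) * u x * v x := by
  have hp0 := exponent_pos p
  have hweight : (V x ^ (1 / p)) ^ (p - 2) * V x ^ (1 / p) * V x ^ (1 / p) = V x := by
    rw [← Real.rpow_mul hx.le, ← Real.rpow_add hx, ← Real.rpow_add hx,
      show 1 / p * (p - 2) + 1 / p + 1 / p = 1 by field_simp; ring, Real.rpow_one]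
  rw [RCLike.inner_apply, conj_trivial, weighted, weighted, norm_mul,
    Real.norm_of_nonneg (Real.rpow_nonneg hx.le _), Real.norm_eq_abs,
    Real.mul_rpow (Real.rpow_nonneg hx.le _) (abs_nonneg _)]
  linear_combination (|u x| ^ (p - 2) * u x * v x) * hweight

variable (p) in
/-- The hypotheses on the coefficients `A` and `g` under which the energy is studied. -/
structure IsAdmissible (A g : E N → ℝ → ℝ) : Prop where
  caratheodory_A : IsCaratheodory 1 A
  bounded_A : LocallyEssBounded A
  bounded_partialT : LocallyEssBounded (partialT A)
  caratheodory_g : IsCaratheodory 0 g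
  growth_g : HasLocalGrowth p g

variable (p N) in
/-- The Lagrangian of `∫ V |u|^p`, on fields `(u, V^(1/p) u, ∇u)`. -/
noncomputable def potentialLagrangian :
    Lagrangian ℝ (ℝ × E N) (volume : Measure (E N)) p :=
  .normRpow (.fst ℝ ℝ (E N) ∘L .snd ℝ ℝ (ℝ × E N))

lemma potentialLagrangian_density_jet_ae_eq (u : X hp.out hV) :
    (fun x => (potentialLagrangian N p).density x ((jet hV).toLp u x))
      =ᵐ[volume] fun x => V x * |u x| ^ p := by
  filter_upwards [coeFn_jet hV u, weighted_rpow hp.out hV u] with x hx hV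
  rw [hx]
  exact hV

lemma potentialLagrangian_regular_jet_ae_eq (u v : X hp.out hV) :
    (fun x => (potentialLagrangian N p).regular x ((jet hV).toLp u x) ((jet hV).toLp v x))
      =ᵐ[volume] fun x => p * (V x * |u x| ^ (p - 2) * u x * v x) := by
  filter_upwards [coeFn_jet hV u, coeFn_jet hV v, hV.ae_pos] with x hu hv hx
  rw [hu, hv, ← norm_weighted_rpow_mul_inner_weighted u v hx]
  exact fderiv_norm_rpow_comp_apply _ _ _

namespace IsAdmissible

variable (h : IsAdmissible p A g)

/-- The Lagrangian of `∫ A(x, u) |∇u|^p`, on fields `(u, V^(1/p) u, ∇u)`. -/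
noncomputable def gradientLagrangian :
    Lagrangian ℝ (ℝ × E N) (volume : Measure (E N)) p :=
  .principal h.caratheodory_A h.bounded_A h.bounded_partialT
    (.snd ℝ ℝ (E N) ∘L .snd ℝ ℝ (ℝ × E N))

/-- The Lagrangian of `∫ G(x, u)`, on fields `(u, V^(1/p) u, ∇u)`. -/
noncomputable def sourceLagrangian :
    Lagrangian ℝ (ℝ × E N) (volume : Measure (E N)) p :=
  .ofPrimitive (ℝ × E N) h.caratheodory_g h.growth_g

lemma gradientLagrangian_density_jet_ae_eq (u : X hp.out hV) :
    (fun x => h.gradientLagrangian.density x ((jet hV).toLp u x))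
      =ᵐ[volume] fun x => A x (u x) * ‖u.grad x‖ ^ p := by
  filter_upwards [coeFn_jet hV u] with x hx
  rw [hx]
  rfl

lemma gradientLagrangian_regular_jet_ae_eq (u v : X hp.out hV) :
    (fun x => h.gradientLagrangian.regular x ((jet hV).toLp u x) ((jet hV).toLp v x))
      =ᵐ[volume] fun x =>
        p * (A x (u x) * ‖u.grad x‖ ^ (p - 2) * inner ℝ (u.grad x) (v.grad x)) := by
  filter_upwards [coeFn_jet hV u, coeFn_jet hV v] with x hu hv
  rw [hu, hv]
  exact Lagrangian.principal_regular_apply _ _ _ _ _ _ _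

lemma gradientLagrangian_singular_jet_ae_eq (u v : X hp.out hV) :
    (fun x => h.gradientLagrangian.singular x ((jet hV).toLp u x) ((jet hV).toLp v x).1)
      =ᵐ[volume] fun x => partialT A x (u x) * v x * ‖u.grad x‖ ^ p := by
  filter_upwards [coeFn_jet hV u, coeFn_jet hV v] with x hu hv
  rw [hu, hv]
  exact Lagrangian.principal_singular_apply _ _ _ _ _ _ _

lemma sourceLagrangian_density_jet_ae_eq (u : X hp.out hV) :
    (fun x => h.sourceLagrangian.density x ((jet hV).toLp u x))
      =ᵐ[volume] fun x => primitive g x (u x) := by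
  filter_upwards [coeFn_jet hV u] with x hx
  rw [hx]
  rfl

lemma sourceLagrangian_regular_jet_ae_eq (u v : X hp.out hV) :
    (fun x => h.sourceLagrangian.regular x ((jet hV).toLp u x) ((jet hV).toLp v x))
      =ᵐ[volume] fun x => g x (u x) * v x := by
  filter_upwards [coeFn_jet hV u, coeFn_jet hV v] with x hu hv
  rw [hu, hv]
  exact Lagrangian.ofPrimitive_regular_apply _ _ _ _ _

include h

lemma integralsConverge (u v : X hp.out hV) : IntegralsConverge A g u v where
  energy_A := (h.gradientLagrangian.integrable (jet hV) u).congr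
    (h.gradientLagrangian_density_jet_ae_eq u)
  energy_V := u.memX.integrable_weight
  energy_G := (h.sourceLagrangian.integrable (jet hV) u).congr
    (h.sourceLagrangian_density_jet_ae_eq u)
  diff_A := (integrable_const_mul_iff (exponent_pos p).ne'.isUnit _).1
    ((h.gradientLagrangian.integrable_regular (jet hV) u v).congr
      (h.gradientLagrangian_regular_jet_ae_eq u v))
  diff_At := (h.gradientLagrangian.integrable_singular (jet hV) u v).congr
    (h.gradientLagrangian_singular_jet_ae_eq u v)
  diff_V := (integrable_const_mul_iff (exponent_pos p).ne'.isUnit _).1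
    (((potentialLagrangian N p).integrable_regular (jet hV) u v).congr
      (potentialLagrangian_regular_jet_ae_eq u v))
  diff_g := (h.sourceLagrangian.integrable_regular (jet hV) u v).congr
    (h.sourceLagrangian_regular_jet_ae_eq u v)

lemma energy_eq (u : X hp.out hV) : energy A g u = 1 / p * h.gradientLagrangian.action (jet hV) u
    + 1 / p * (potentialLagrangian N p).action (jet hV) u
    - h.sourceLagrangian.action (jet hV) u := by
  rw [energy, Lagrangian.action, Lagrangian.action, Lagrangian.action,
    integral_congr_ae (h.gradientLagrangian_density_jet_ae_eq u),
    integral_congr_ae (potentialLagrangian_density_jet_ae_eq u),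
    integral_congr_ae (h.sourceLagrangian_density_jet_ae_eq u)]

variable (hV) in
/-- The differential of `energy A g`. -/
noncomputable def differential (u : X hp.out hV) : X hp.out hV →L[ℝ] ℝ :=
  (1 / p) • h.gradientLagrangian.firstVariation (jet hV) u
    + (1 / p) • (potentialLagrangian N p).firstVariation (jet hV) u
    - h.sourceLagrangian.firstVariation (jet hV) u

lemma differential_apply (u v : X hp.out hV) : h.differential hV u v = diffEnergy A g u v := by
  have hp0 := (exponent_pos p).ne'
  rw [differential, sub_apply, add_apply, smul_apply, smul_apply, Lagrangian.firstVariation_apply,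
    Lagrangian.firstVariation_apply, Lagrangian.firstVariation_apply,
    integral_congr_ae (h.gradientLagrangian_regular_jet_ae_eq u v),
    integral_congr_ae (h.gradientLagrangian_singular_jet_ae_eq u v),
    integral_congr_ae (potentialLagrangian_regular_jet_ae_eq u v),
    integral_congr_ae (h.sourceLagrangian_regular_jet_ae_eq u v),
    integral_const_mul, integral_const_mul]
  have hpot : ∀ x z, (potentialLagrangian N p).singular x z = 0 := fun _ _ => rfl
  have hsource : ∀ x z, h.sourceLagrangian.singular x z = 0 := fun _ _ => rfl
  simp only [hpot, hsource, zero_apply, integral_zero, diffEnergy, smul_eq_mul]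
  field_simp
  ring

lemma hasFDerivAt_energy (u : X hp.out hV) :
    HasFDerivAt (energy A g) (h.differential hV u) u := by
  refine HasFDerivAt.congr_of_eventuallyEq ?_ (.of_forall h.energy_eq)
  exact (((h.gradientLagrangian.hasFDerivAt_action (jet hV) u).const_mul (1 / p)).add
    (((potentialLagrangian N p).hasFDerivAt_action (jet hV) u).const_mul (1 / p))).sub
    (h.sourceLagrangian.hasFDerivAt_action (jet hV) u)

variable {un : ℕ → X hp.out hV} {u : X hp.out hV} {M : ℝ}

lemma tendsto_energy (hlim : Tendsto (fun n => (un n - u).normV) atTop (𝓝 0))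
    (hun : ∀ n, (un n).normInfty ≤ M) :
    Tendsto (fun n => energy A g (un n)) atTop (𝓝 (energy A g u)) := by
  have hbdd : ∀ n, ‖(jet hV).toLinfty (un n)‖ ≤ M := fun n =>
    (norm_jet_toLinfty hV (un n)).trans_le (hun n)
  have hjet := tendsto_jet hV hlim
  simp only [h.energy_eq]
  exact (((h.gradientLagrangian.tendsto_action hbdd hjet).const_mul _).add
    (((potentialLagrangian N p).tendsto_action hbdd hjet).const_mul _)).sub
    (h.sourceLagrangian.tendsto_action hbdd hjet)

lemma tendsto_differential (hlim : Tendsto (fun n => (un n - u).normV) atTop (𝓝 0))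
    (hun : ∀ n, (un n).normInfty ≤ M) :
    Tendsto (fun n => h.differential hV (un n)) atTop (𝓝 (h.differential hV u)) := by
  have hbdd : ∀ n, ‖(jet hV).toLinfty (un n)‖ ≤ M := fun n =>
    (norm_jet_toLinfty hV (un n)).trans_le (hun n)
  have hjet := tendsto_jet hV hlim
  exact (((h.gradientLagrangian.tendsto_firstVariation hbdd hjet).const_smul _).add
    (((potentialLagrangian N p).tendsto_firstVariation hbdd hjet).const_smul _)).sub
    (h.sourceLagrangian.tendsto_firstVariation hbdd hjet)

lemma continuous_differential : Continuous (h.differential hV) :=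
  (((h.gradientLagrangian.continuous_firstVariation (J := jet hV)).const_smul (1 / p)).add
    (((potentialLagrangian N p).continuous_firstVariation (J := jet hV)).const_smul (1 / p))).sub
    (h.sourceLagrangian.continuous_firstVariation (J := jet hV))

lemma contDiff_energy : ContDiff ℝ 1 (energy A g : X hp.out hV → ℝ) :=
  contDiff_one_iff_hasFDerivAt.2
    ⟨h.differential hV, h.continuous_differential, h.hasFDerivAt_energy⟩

end IsAdmissible

end Energy

end WeightedSobolev

open WeightedSobolev in
theorem proposition3p7_general {N : ℕ} {p : ℝ} (hp : 1 < p) {V : E N → ℝ} (hV : IsPotential V)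
    {A g : E N → ℝ → ℝ} (hA : IsCaratheodory 1 A) (hA_bdd : LocallyEssBounded A)
    (hAt_bdd : LocallyEssBounded (partialT A)) (hg : IsCaratheodory 0 g)
    (hg_growth : HasLocalGrowth p g) :
    (∀ u v : X hp hV, IntegralsConverge A g u v) ∧
    ∃ dJ : X hp hV → (X hp hV →L[ℝ] ℝ),
      (∀ u v : X hp hV, dJ u v = diffEnergy A g u v) ∧
      (∀ (u_ : ℕ → X hp hV) (u : X hp hV) (M : ℝ),
        Tendsto (fun n => (u_ n - u).normV) atTop (𝓝 0) →
        (∀ n, (u_ n).normInfty ≤ M) →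
        Tendsto (fun n => energy A g (u_ n)) atTop (𝓝 (energy A g u)) ∧
          Tendsto (fun n => ‖dJ (u_ n) - dJ u‖) atTop (𝓝 0)) ∧
      (∀ u : X hp hV, HasFDerivAt (energy A g : X hp hV → ℝ) (dJ u) u) ∧
      ContDiff ℝ 1 (energy A g : X hp hV → ℝ) := by
  have : Fact (1 < p) := ⟨hp⟩
  have h : IsAdmissible p A g := ⟨hA, hA_bdd, hAt_bdd, hg, hg_growth⟩
  exact ⟨h.integralsConverge, h.differential hV, h.differential_apply,
    fun _ _ _ hlim hM => ⟨h.tendsto_energy hlim hM,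
      tendsto_iff_norm_sub_tendsto_zero.1 (h.tendsto_differential hlim hM)⟩,
    h.hasFDerivAt_energy, h.contDiff_energy⟩

theorem proposition3p7 {N : ℕ} (hN : 2 ≤ N) {p : ℝ} (hp : 1 < p)
    {V : WeightedSobolev.E N → ℝ} (hV : WeightedSobolev.IsPotential V)
    {A g : WeightedSobolev.E N → ℝ → ℝ}
    (hA : WeightedSobolev.IsCaratheodory 1 A)
    (hA_bdd : WeightedSobolev.LocallyEssBounded A)
    (hAt_bdd : WeightedSobolev.LocallyEssBounded (WeightedSobolev.partialT A))
    (hg : WeightedSobolev.IsCaratheodory 0 g)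
    (hg_growth : WeightedSobolev.HasGrowth p g) :
    (∀ u v : WeightedSobolev.X hp hV, WeightedSobolev.IntegralsConverge A g u v) ∧
    ∃ dJ : WeightedSobolev.X hp hV → (WeightedSobolev.X hp hV →L[ℝ] ℝ),
      (∀ u v : WeightedSobolev.X hp hV, dJ u v = WeightedSobolev.diffEnergy A g u v) ∧
      (∀ (u_ : ℕ → WeightedSobolev.X hp hV) (u : WeightedSobolev.X hp hV) (M : ℝ), 0 < M →
        (∀ᵐ x ∂(volume : Measure (WeightedSobolev.E N)),
          Tendsto (fun n => u_ n x) atTop (𝓝 (u x))) →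
        Tendsto (fun n => (u_ n - u).normV) atTop (𝓝 0) →
        (∀ n, (u_ n).normInfty ≤ M) →
        Tendsto (fun n => WeightedSobolev.energy A g (u_ n)) atTop
            (𝓝 (WeightedSobolev.energy A g u)) ∧
          Tendsto (fun n => ‖dJ (u_ n) - dJ u‖) atTop (𝓝 0)) ∧
      (∀ u : WeightedSobolev.X hp hV,
        HasFDerivAt (WeightedSobolev.energy A g : WeightedSobolev.X hp hV → ℝ) (dJ u) u) ∧
      ContDiff ℝ 1 (WeightedSobolev.energy A g : WeightedSobolev.X hp hV → ℝ) := by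
  obtain ⟨hint, dJ, hdJ, hlim, hderiv, hC1⟩ :=
    proposition3p7_general hp hV hA hA_bdd hAt_bdd hg (hg_growth.hasLocalGrowth hp.le)
  exact ⟨hint, dJ, hdJ, fun u_ u M _ _ => hlim u_ u M, hderiv, hC1⟩
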